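/- Let $p$ be an odd prime, $\mathbf{F}$ a field of characteristic $p$, and $L=\bigoplus_{i\ge 1}L_i$ an infinite-dimensional graded Lie algebra of maximal class over $\mathbf{F}$; that is, $\dim L_1=2$, $\dim L_i\le 1$ for $i\ge 2$, and $L$ is generated by $L_1$. For $i\ge 2$ let $C_i=C_{L_1}(L_i)$ be its two-step centralizers. If some $C_n$ differs from $C_2$, let $n$ be the least such index. The first constituent of $L$ is the sequence $C_2,\dots,C_n$, to which one assigns the length $n=2q$ (here $q$, which is a power of $p$, is the parameter of $L$). The further constituents are the sequences $C_{i+1},\dots,C_{i+m}$ with $C_i\ne C_2$, $C_{i+m}\ne C_2$ and $C_{i+1}=\dots=C_{i+m-1}=C_2$, where $i\ge 2$ and $m\ge 1$; such a constituent has length $m$. A constituent is called long if its length is $2q$ and short if its length is $q$. The deflation $L^{\downarrow}$ of $L$ is the Lie algebra $\bigoplus_{i\ge 1}L_{pi}$ extended by the derivation $(\operatorname{ad}x)^p$, for some $x\in L_1\setminus C_2$; it is graded by giving weight $i$ to $L_{pi}$ and weight $1$ to $(\operatorname{ad}x)^p$. For a Lie algebra $N=\bigoplus_{i\ge 1}N_i$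 with $\dim N_1=2$ and a one-dimensional subspace $M$ of $N_1$, the inflation ${}^{M}N$ is the Lie algebra $\bigl(M\oplus\bigoplus_{i\ge 2}N_i\bigr)\otimes\mathbf{F}[\varepsilon]/(\varepsilon^p)$ extended by the derivation $1\otimes\frac{d}{d\varepsilon}+\operatorname{ad}s\otimes\varepsilon^{p-1}$, for some $s\in N_1\setminus M$; it is graded by giving weight $pj-i$ to $u\otimes\varepsilon^i$, for $u$ of weight $j$ and $0\le i<p$, and weight $1$ to the derivation. The algebra $L$ is called inflated if, as a graded Lie algebra, $L\cong{}^{M}(L^{\downarrow})$ for some one-dimensional subspace $M$ of $(L^{\downarrow})_1$. Suppose that $L$ has exactly two distinct two-step centralizers, and that among its constituents, taken in order of occurrence, there is a second non-short one and it is long. Then every constituent of $L$ is short or long, and $L$ is inflated. -/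

import Mathlib

open scoped TensorProduct Polynomial

noncomputable section

namespace MaximalClass

attribute [local instance 100] LieRing.ofAssociativeRing

/-! ### Graded Lie algebras of maximal class, two-step centralizers, constituents -/

section Basic

variable {F L : Type*} [Field F] [LieRing L] [LieAlgebra F L]

/-- A graded Lie algebra `L = ⨁_{i ≥ 1} 𝒢 i` is of maximal class if `dim (𝒢 1) = 2`,
`dim (𝒢 i) ≤ 1` for `i ≥ 2`, and `L` is generated by `𝒢 1`. -/
structure IsMaximalClass (𝒢 : ℕ → Submodule F L) [GradedLieAlgebra 𝒢] : Prop where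
  zero_eq_bot : 𝒢 0 = ⊥
  rank_one : Module.rank F (𝒢 1) = 2
  rank_le_one : ∀ i, 2 ≤ i → Module.rank F (𝒢 i) ≤ 1
  generated : LieSubalgebra.lieSpan F L (𝒢 1 : Set L) = ⊤

/-- The two-step centralizer `C_i`, the centralizer in `𝒢 1` of `𝒢 i`; meant for `i ≥ 2`. -/
def twoStep (𝒢 : ℕ → Submodule F L) (i : ℕ) : Submodule F L where
  carrier := {u | u ∈ 𝒢 1 ∧ ∀ v ∈ 𝒢 i, ⁅u, v⁆ = 0}
  add_mem' := fun ha hb =>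
    ⟨add_mem ha.1 hb.1, fun v hv => by rw [add_lie, ha.2 v hv, hb.2 v hv, add_zero]⟩
  zero_mem' := ⟨zero_mem _, fun v _ => zero_lie v⟩
  smul_mem' := fun c _ ha =>
    ⟨Submodule.smul_mem _ c ha.1, fun v hv => by rw [smul_lie, ha.2 v hv, smul_zero]⟩

/-- The set of all two-step centralizers `C_i`, `i ≥ 2`. -/
def twoStepSet (𝒢 : ℕ → Submodule F L) : Set (Submodule F L) :=
  twoStep 𝒢 '' Set.Ici 2

/-- `IsConstituent 𝒢 i m`: there is a constituent of length `m` which ends with `C_{i+m}` and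
which, unless it is the first one, starts with `C_{i+1}`. The first constituent
`C_2, …, C_m` is given the position `i = 0` and, by convention, the length `m`. -/
inductive IsConstituent (𝒢 : ℕ → Submodule F L) : ℕ → ℕ → Prop
  | first (m : ℕ) (hm : 2 ≤ m) (hlast : twoStep 𝒢 m ≠ twoStep 𝒢 2)
      (hinner : ∀ j, 2 ≤ j → j < m → twoStep 𝒢 j = twoStep 𝒢 2) : IsConstituent 𝒢 0 m
  | later (i m : ℕ) (hi : 2 ≤ i) (hm : 1 ≤ m) (hprev : twoStep 𝒢 i ≠ twoStep 𝒢 2)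
      (hlast : twoStep 𝒢 (i + m) ≠ twoStep 𝒢 2)
      (hinner : ∀ j, i < j → j < i + m → twoStep 𝒢 j = twoStep 𝒢 2) : IsConstituent 𝒢 i m

/-- The weight in which the second two-step centralizer first occurs, that is, the length of the
first constituent. -/
def firstLength (𝒢 : ℕ → Submodule F L) : ℕ :=
  sInf {n | 2 ≤ n ∧ twoStep 𝒢 n ≠ twoStep 𝒢 2}

/-- A length `m` is long if it equals `2 q`, where `2 q` is the length of the first
constituent. -/
def IsLong (𝒢 : ℕ → Submodule F L) (m : ℕ) : Prop :=
  m = firstLength 𝒢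

/-- A length `m` is short if it equals `q`, where `2 q` is the length of the first
constituent. -/
def IsShort (𝒢 : ℕ → Submodule F L) (m : ℕ) : Prop :=
  2 * m = firstLength 𝒢

/-- The constituent at position `i`, of length `m`, is the second non-short one: it is not short,
and exactly one earlier constituent is not short. -/
def IsSecondNonShort (𝒢 : ℕ → Submodule F L) (i m : ℕ) : Prop :=
  IsConstituent 𝒢 i m ∧ ¬ IsShort 𝒢 m ∧
    {j : ℕ | j < i ∧ ∃ l, IsConstituent 𝒢 j l ∧ ¬ IsShort 𝒢 l}.ncard = 1

end Basic

/-! ### Extending a Lie algebra by a derivation -/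

section Extension

variable {F K : Type*} [Field F] [LieRing K] [LieAlgebra F K]

/-- The homomorphism from the one-dimensional Lie algebra `F` that sends `a` to `a D`. -/
def derHom (D : LieDerivation F K K) : F →ₗ⁅F⁆ LieDerivation F K K where
  toFun a := a • D
  map_add' a b := add_smul a b D
  map_smul' a b := mul_smul a b D
  map_lie' := by
    intro a b
    ext v
    simp [LieRing.of_associative_ring_bracket, mul_comm]

/-- The Lie algebra `K ⋊ F s`, in which `s = ⟨0, 1⟩` acts on `K` as the derivation `D`. -/
abbrev DerExt (D : LieDerivation F K K) : Type _ :=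
  LieAlgebra.SemiDirectSum K F (derHom D)

end Extension

/-! ### Deflation -/

section Deflation

variable {F L : Type*} [Field F] [LieRing L] [LieAlgebra F L]

/-- In characteristic `p`, the `p`-th power of the inner derivation `ad x` is a derivation. -/
def adPow (F : Type*) {L : Type*} [Field F] [LieRing L] [LieAlgebra F L]
    (p : ℕ) [Fact p.Prime] [CharP F p] (x : L) : LieDerivation F L L where
  toLinearMap := (LieAlgebra.ad F L x) ^ p
  leibniz' a b := by
    have hp : p.Prime := Fact.out
    have hD : ∀ v : L, (LieAlgebra.ad F L x ^ p) v = (LieDerivation.ad F L x)^[p] v := by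
      intro v
      rw [Module.End.pow_apply, ← LieDerivation.coe_ad_apply_eq_ad_apply]
      rfl
    have hmid : ∀ i ∈ Finset.range p, i ∉ ({0} : Finset ℕ) →
        p.choose i • ⁅(LieDerivation.ad F L x)^[i] a, (LieDerivation.ad F L x)^[p - i] b⁆ = 0 := by
      intro i hi hi0
      have hdvd : p ∣ p.choose i := hp.dvd_choose_self (by simpa using hi0) (by simpa using hi)
      rw [← Nat.cast_smul_eq_nsmul F, (CharP.cast_eq_zero_iff F p _).2 hdvd, zero_smul]
    rw [hD, hD, hD, LieDerivation.iterate_apply_lie', Finset.sum_range_succ,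
      ← Finset.sum_subset (by simpa using hp.pos) hmid]
    simp only [Finset.sum_singleton, Nat.choose_zero_right, Nat.choose_self, one_smul, Nat.sub_zero,
      Nat.sub_self, Function.iterate_zero, id_eq]
    rw [← lie_skew b, sub_neg_eq_add, add_comm]

/-- The subalgebra `⨁_i 𝒢 (p i)`. -/
def multiples (p : ℕ) (𝒢 : ℕ → Submodule F L) [SetLike.GradedBracket 𝒢] : LieSubalgebra F L where
  toSubmodule := ⨆ i, 𝒢 (p * i)
  lie_mem' := by
    intro u v hu hv
    change u ∈ ⨆ i, 𝒢 (p * i) at hu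
    change v ∈ ⨆ i, 𝒢 (p * i) at hv
    change ⁅u, v⁆ ∈ ⨆ i, 𝒢 (p * i)
    induction hu using Submodule.iSup_induction' with
    | zero => simp
    | add a b _ _ ha hb => rw [add_lie]; exact add_mem ha hb
    | mem i a ha =>
      induction hv using Submodule.iSup_induction' with
      | zero => simp
      | add c d _ _ hc hd => rw [lie_add]; exact add_mem hc hd
      | mem j c hc =>
        refine Submodule.mem_iSup_of_mem (i + j) ?_
        rw [mul_add]
        exact SetLike.GradedBracket.bracket_mem ha hc

variable (p : ℕ) [Fact p.Prime] [CharP F p] (𝒢 : ℕ → Submodule F L) [SetLike.GradedBracket 𝒢]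

theorem adPow_mem (x : L) (hx : x ∈ 𝒢 1) (n : ℕ) (v : L) (hv : v ∈ 𝒢 n) :
    adPow F p x v ∈ 𝒢 (n + p) := by
  have key : ∀ k : ℕ, ((LieAlgebra.ad F L x) ^ k) v ∈ 𝒢 (n + k) := by
    intro k
    induction k with
    | zero => simpa using hv
    | succ k ih =>
      rw [pow_succ', Module.End.mul_apply, LieAlgebra.ad_apply]
      have := SetLike.GradedBracket.bracket_mem (ℒ := 𝒢) hx ih
      rwa [show n + (k + 1) = 1 + (n + k) by ring]
  exact key p

theorem adPow_mem_multiples (x : L) (hx : x ∈ 𝒢 1) (v : L) (hv : v ∈ multiples p 𝒢) :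
    adPow F p x v ∈ multiples p 𝒢 := by
  change v ∈ ⨆ i, 𝒢 (p * i) at hv
  change _ ∈ ⨆ i, 𝒢 (p * i)
  induction hv using Submodule.iSup_induction' with
  | zero => simp
  | add a b _ _ ha hb => rw [map_add]; exact add_mem ha hb
  | mem i a ha => exact Submodule.mem_iSup_of_mem (i + 1) (adPow_mem p 𝒢 x hx _ a ha)

/-- The derivation `(ad x)^p` of `⨁_i 𝒢 (p i)`, for `x` of weight `1`. -/
def deflationDer (x : L) (hx : x ∈ 𝒢 1) :
    LieDerivation F (multiples p 𝒢) (multiples p 𝒢) where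
  toLinearMap := (adPow F p x).toLinearMap.restrict
    (p := (multiples p 𝒢).toSubmodule) (q := (multiples p 𝒢).toSubmodule) (adPow_mem_multiples p 𝒢 x hx)
  leibniz' a b := Subtype.ext ((adPow F p x).apply_lie_eq_sub (a : L) (b : L))

/-- The deflation of the algebra of maximal class with grading `𝒢`: the Lie algebra
`⨁_i 𝒢 (p i)`, extended by the derivation `(ad x)^p`. Here `x ∈ 𝒢 1` is to be taken outside
`C_2`; the choice does not matter up to graded isomorphism. -/
abbrev Deflation (x : L) (hx : x ∈ 𝒢 1) : Type _ :=
  DerExt (deflationDer p 𝒢 x hx)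

/-- The grading of the deflation: `𝒢 (p n)` has weight `n`, and the derivation `(ad x)^p` has
weight `1`. -/
def deflationGrading (x : L) (hx : x ∈ 𝒢 1) (n : ℕ) : Submodule F (Deflation p 𝒢 x hx) where
  carrier := {z | (z.left : L) ∈ 𝒢 (p * n) ∧ (n ≠ 1 → z.right = 0)}
  add_mem' := fun ha hb =>
    ⟨add_mem ha.1 hb.1, fun h => by
      rw [LieAlgebra.SemiDirectSum.add_eq_mk, ha.2 h, hb.2 h, add_zero]⟩
  zero_mem' := ⟨zero_mem _, fun _ => rfl⟩
  smul_mem' := fun c _ ha =>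
    ⟨Submodule.smul_mem _ c ha.1, fun h => by
      rw [LieAlgebra.SemiDirectSum.smul_eq_mk, ha.2 h, smul_zero]⟩

instance deflationGrading_gradedBracket (x : L) (hx : x ∈ 𝒢 1) :
    SetLike.GradedBracket (deflationGrading p 𝒢 x hx) where
  bracket_mem := by
    intro i j z w hz hw
    have hzw : ∀ {i j : ℕ} {z w : Deflation p 𝒢 x hx}, z ∈ deflationGrading p 𝒢 x hx i →
        w ∈ deflationGrading p 𝒢 x hx j →
        z.right • adPow F p x (w.left : L) ∈ 𝒢 (p * (i + j)) := by
      intro i j z w hz hw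
      by_cases hi : i = 1
      · refine Submodule.smul_mem _ _ ?_
        rw [hi, show p * (1 + j) = p * j + p by ring]
        exact adPow_mem p 𝒢 x hx _ _ hw.1
      · rw [hz.2 hi, zero_smul]
        exact zero_mem _
    refine ⟨?_, fun _ => ?_⟩
    · refine sub_mem (add_mem ?_ (hzw hz hw)) ?_
      · rw [mul_add]
        exact SetLike.GradedBracket.bracket_mem hz.1 hw.1
      · rw [add_comm i j]
        exact hzw hw hz
    · rw [LieAlgebra.SemiDirectSum.lie_eq_mk]
      simp [LieRing.of_associative_ring_bracket, mul_comm]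

theorem deflationGrading_zero (h0 : 𝒢 0 = ⊥) (x : L) (hx : x ∈ 𝒢 1) :
    deflationGrading p 𝒢 x hx 0 = ⊥ := by
  refine eq_bot_iff.2 fun z hz => ?_
  have h1 : (z.left : L) ∈ 𝒢 (p * 0) := hz.1
  rw [mul_zero, h0, Submodule.mem_bot] at h1
  exact (Submodule.mem_bot F).2
    (LieAlgebra.SemiDirectSum.ext (Subtype.ext h1) (hz.2 zero_ne_one))

theorem iSup_deflationGrading (x : L) (hx : x ∈ 𝒢 1) :
    ⨆ n, deflationGrading p 𝒢 x hx n = ⊤ := by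
  have hl : ∀ (v : L) (hv : v ∈ ⨆ i, 𝒢 (p * i)),
      (⟨⟨v, hv⟩, 0⟩ : Deflation p 𝒢 x hx) ∈ ⨆ n, deflationGrading p 𝒢 x hx n := by
    intro v hv
    induction hv using Submodule.iSup_induction' with
    | zero => exact zero_mem _
    | mem i a ha => exact Submodule.mem_iSup_of_mem i ⟨ha, fun _ => rfl⟩
    | add a b ha' hb' ha hb =>
      have := add_mem ha hb
      rw [LieAlgebra.SemiDirectSum.add_eq_mk, add_zero] at this
      exact this
  refine eq_top_iff.2 fun z _ => ?_
  have h1 := hl z.left z.left.2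
  have h2 : (⟨0, z.right⟩ : Deflation p 𝒢 x hx) ∈ ⨆ n, deflationGrading p 𝒢 x hx n :=
    Submodule.mem_iSup_of_mem 1 ⟨zero_mem _, fun h => absurd rfl h⟩
  have h3 := add_mem h1 h2
  rw [LieAlgebra.SemiDirectSum.add_eq_mk] at h3
  simpa using h3

end Deflation

/-! ### Inflation -/

section Inflation

variable {F : Type*} [Field F]

/-- The truncated polynomial algebra `F[ε]/(ε^p)`. -/
abbrev Trunc (F : Type*) [Field F] (p : ℕ) : Type _ :=
  AdjoinRoot (Polynomial.X ^ p : F[X])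

/-- The class `ε` of the indeterminate. -/
def eps (F : Type*) [Field F] (p : ℕ) : Trunc F p :=
  AdjoinRoot.root _

/-- The derivation `d/dε` of `F[ε]/(ε^p)`, in characteristic `p`. -/
def truncDer (F : Type*) [Field F] (p : ℕ) [CharP F p] :
    Derivation F (Trunc F p) (Trunc F p) :=
  Derivation.liftOfSurjective (f := AdjoinRoot.mkₐ (Polynomial.X ^ p : F[X]))
    (d := Polynomial.derivative') AdjoinRoot.mk_surjective (by
      intro f hf
      obtain ⟨g, rfl⟩ := AdjoinRoot.mk_eq_zero.1 hf
      refine AdjoinRoot.mk_eq_zero.2 ⟨Polynomial.derivative g, ?_⟩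
      simp)

variable {N : Type*} [LieRing N] [LieAlgebra F N]

/-- The derivation of an ideal `I` induced by `ad s`. -/
def idealDer (I : LieIdeal F N) (s : N) : LieDerivation F I I where
  toLinearMap := LieModule.toEnd F N I s
  leibniz' a b := by
    refine Subtype.ext ?_
    change ⁅s, ⁅(a : N), (b : N)⁆⁆ = ⁅(a : N), ⁅s, (b : N)⁆⁆ - ⁅(b : N), ⁅s, (a : N)⁆⁆
    rw [leibniz_lie s, ← lie_skew (b : N) ⁅s, (a : N)⁆]
    abel

/-- The derivation `d/dε ⊗ 1 + ε^(p-1) ⊗ ad s` of `F[ε]/(ε^p) ⊗ I`. -/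
def inflationDer (p : ℕ) [CharP F p] (I : LieIdeal F N) (s : N) :
    LieDerivation F (Trunc F p ⊗[F] I) (Trunc F p ⊗[F] I) :=
  Lie.Derivation.ofDerivation I (truncDer F p) +
    (eps F p ^ (p - 1)) • Lie.Derivation.ofLieDerivation (Trunc F p) (idealDer I s)

/-- The ideal `M ⊕ ⨁_{i ≥ 2} ℋ i` of `N = ⨁_{i ≥ 1} ℋ i`, for a subspace `M` of `ℋ 1`. -/
def idealOf (ℋ : ℕ → Submodule F N) [SetLike.GradedBracket ℋ] (h0 : ℋ 0 = ⊥)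
    (hsup : ⨆ i, ℋ i = ⊤) (M : Submodule F N) : LieIdeal F N where
  toSubmodule := M ⊔ ⨆ i, ℋ (i + 2)
  lie_mem := by
    intro u v hv0
    clear hv0
    have hu : u ∈ ⨆ i, ℋ i := hsup ▸ Submodule.mem_top
    have hv : v ∈ ⨆ i, ℋ i := hsup ▸ Submodule.mem_top
    refine Submodule.mem_sup_right ?_
    induction hu using Submodule.iSup_induction' with
    | zero => simp
    | add a b _ _ ha hb => rw [add_lie]; exact add_mem ha hb
    | mem i a ha =>
      induction hv using Submodule.iSup_induction' with
      | zero => simp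
      | add c d _ _ hc hd => rw [lie_add]; exact add_mem hc hd
      | mem j c hc =>
        rcases Nat.eq_zero_or_pos i with rfl | hi
        · rw [h0, Submodule.mem_bot] at ha
          simp [ha]
        rcases Nat.eq_zero_or_pos j with rfl | hj
        · rw [h0, Submodule.mem_bot] at hc
          simp [hc]
        refine Submodule.mem_iSup_of_mem (i + j - 2) ?_
        rw [show i + j - 2 + 2 = i + j by omega]
        exact SetLike.GradedBracket.bracket_mem ha hc

/-- The inflation of `N` with respect to the ideal `I` of codimension one: the Lie algebra
`F[ε]/(ε^p) ⊗ I`, extended by the derivation `d/dε ⊗ 1 + ε^(p-1) ⊗ ad s`. Here `s` is to be taken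
of weight `1` and outside `I`; the choice does not matter up to graded isomorphism. -/
abbrev Inflation (p : ℕ) [CharP F p] (I : LieIdeal F N) (s : N) : Type _ :=
  DerExt (inflationDer p I s)

/-- The grading of the inflation: for `0 ≤ i < p`, the elements of `ε^i ⊗ (I ∩ ℋ j)` have weight
`p j - i`, and the derivation which extends `F[ε]/(ε^p) ⊗ I` has weight `1`. -/
def inflationGrading (p : ℕ) [CharP F p] (ℋ : ℕ → Submodule F N) (I : LieIdeal F N) (s : N)
    (n : ℕ) : Submodule F (Inflation p I s) where
  carrier := {z |
    z.left ∈ (⨆ (j : ℕ) (i : ℕ) (_ : i < p ∧ n + i = p * j),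
      ((ℋ j).comap I.toSubmodule.subtype).map
        (TensorProduct.mk F (Trunc F p) I (eps F p ^ i))) ∧
    (n ≠ 1 → z.right = 0)}
  add_mem' := fun ha hb =>
    ⟨add_mem ha.1 hb.1, fun h => by
      rw [LieAlgebra.SemiDirectSum.add_eq_mk, ha.2 h, hb.2 h, add_zero]⟩
  zero_mem' := ⟨zero_mem _, fun _ => rfl⟩
  smul_mem' := fun c _ ha =>
    ⟨Submodule.smul_mem _ c ha.1, fun h => by
      rw [LieAlgebra.SemiDirectSum.smul_eq_mk, ha.2 h, smul_zero]⟩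

end Inflation

/-! ### Inflated algebras -/

section Inflated

variable {F L : Type*} [Field F] [LieRing L] [LieAlgebra F L]

/-- `L` is inflated: it is isomorphic, as a graded Lie algebra, to the inflation of its deflation
`L↓` with respect to some one-dimensional subspace `M` of the component of weight `1` of `L↓`. -/
def IsInflated (p : ℕ) [Fact p.Prime] [CharP F p] (𝒢 : ℕ → Submodule F L) [GradedLieAlgebra 𝒢]
    (h : IsMaximalClass 𝒢) : Prop :=
  ∃ (x : L) (hx : x ∈ 𝒢 1), x ∉ twoStep 𝒢 2 ∧
  ∃ M : Submodule F (Deflation p 𝒢 x hx),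
    M ≤ deflationGrading p 𝒢 x hx 1 ∧ Module.finrank F M = 1 ∧
  ∃ s ∈ deflationGrading p 𝒢 x hx 1, s ∉ M ∧
  ∃ e : L ≃ₗ⁅F⁆ Inflation p
      (idealOf (deflationGrading p 𝒢 x hx) (deflationGrading_zero p 𝒢 h.zero_eq_bot x hx)
        (iSup_deflationGrading p 𝒢 x hx) M) s,
    ∀ n v, v ∈ 𝒢 n ↔ e v ∈ inflationGrading p (deflationGrading p 𝒢 x hx) _ s n

end Inflated

end MaximalClass

end

noncomputable section

namespace MaximalClass

attribute [local instance 100] LieRing.ofAssociativeRing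

/-! ### Binomial coefficients modulo `p` -/

section Binomial

/-! Let `y` and `x` span the first and the second two-step centralizer, let `v₁ = y` and `v_{i+1} =
[v_i, x + y]`, and let `S i` mean that `x` centralizes `v_i`. The constants in `[v_i, v_j] = ν i j •
v_{i+j}` obey the relations of `IsConstantSystem`, all instances of the Jacobi identity. Bracketing
with `x + y` makes `ν i (j + 1)` a difference, so every constant is a signed binomial sum over the
indicator of `S` (`apply_add`). Bracketing with whichever of `x`, `y` kills `v_j` forces further
equalities and zeros. Contradictions come from evaluating one constant in two ways.

Lengths: a window that meets `S` once gives a binomial coefficient, which the relations force to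
vanish modulo `p`. By Lucas' theorem the first length is `2q` with `q = p^t`, and every later length
is `2q` or `2q - p^s` with `s ≤ t` (`exists_parameter`, `gap_length`).

Exclusion: let the lengths begin with `2q`, then `r` times `q`, then `2q`, and consider the earliest
length `m` strictly between `q` and `2q`, preceded by `2q` and `k` times `q`. A difference of order
`q` has only two terms (`add_pow`), so brackets with the elements of weight `2q, 3q, …` follow short
recursions. They give `r ≤ k ≤ r + 1` (`r_le`, `k_le`), and both remaining values fail (`k_ne`, and
`k_ne_of_next`, which also looks at the constituent after the bad one). Hence `gap_short_or_long`.

Inflation: all lengths are now multiples of `p`, so `S` contains only multiples of `p`. Then the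
constants in weights `pj - i` and `pj' - i'` are `C(i + i', i)` times those in weights `pj` and
`pj'`, or zero once `i + i' ≥ p` (`eq_choose_mul`, `eq_zero_of_le`). This is how the elements
`(-1)^i ε^i / i!` multiply in `F[ε]/(ε^p)`, so sending `v_{pj-i}` to `(-1)^i / i! • ε^i ⊗ v_{pj}`
and `x` to the derivation identifies the algebra with the inflation of its deflation
(`exists_lieEquiv`, `isInflated`). -/

theorem choose_prime_pow_modEq {p : ℕ} [Fact p.Prime] (n s : ℕ) :
    n.choose (p ^ s) ≡ n / p ^ s [MOD p] := by
  have hp : p.Prime := Fact.out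
  have h := Choose.choose_modEq_choose_mul_prod_range_choose (p := p) (n := n) (k := p ^ s) s
  have h1 : ∏ i ∈ Finset.range s, ((n / p ^ i % p).choose (p ^ s / p ^ i % p) : ℤ) = 1 := by
    refine Finset.prod_eq_one fun i hi => ?_
    have hi : i < s := by simpa using hi
    have h2 : p ^ s / p ^ i % p = 0 := by
      rw [Nat.pow_div hi.le hp.pos]
      exact Nat.mod_eq_zero_of_dvd (dvd_pow_self p (by omega))
    rw [h2, Nat.choose_zero_right, Nat.cast_one]
  rw [Nat.div_self (pow_pos hp.pos s)] at h
  push_cast at h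
  rw [h1, mul_one] at h
  rw [← Int.natCast_modEq_iff]
  simpa using h

/-- If `p` divides `C(m - 1 + a, a)` for all `0 < a < R`, then `R` is at most a power of `p` that
divides `m`. -/
theorem exists_pow_dvd_of_choose_add {p : ℕ} [Fact p.Prime] {m R : ℕ} (hm : 1 ≤ m)
    (h : ∀ a, 1 ≤ a → a < R → p ∣ (m - 1 + a).choose a) : ∃ s, p ^ s ∣ m ∧ R ≤ p ^ s := by
  have hp : p.Prime := Fact.out
  obtain ⟨s, m', hm', rfl⟩ := Nat.exists_eq_pow_mul_and_not_dvd (n := m) (by omega) p hp.ne_one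
  have hq : 0 < p ^ s := pow_pos hp.pos s
  refine ⟨s, Dvd.intro _ rfl, ?_⟩
  by_contra hR
  -- If `R > p ^ s`, the value `a = p ^ s` is admissible, and by Lucas its coefficient is congruent
  -- to `m'`, the part of `m` prime to `p`.
  have h1 := (Nat.modEq_zero_iff_dvd.2 (h (p ^ s) hq (by omega)))
  have h2 := (choose_prime_pow_modEq (p ^ s * m' - 1 + p ^ s) s).symm.trans h1
  have h3 : (p ^ s * m' - 1 + p ^ s) / p ^ s = m' := by
    rw [show p ^ s * m' - 1 + p ^ s = (p ^ s - 1) + p ^ s * m' by omega,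
      Nat.add_mul_div_left _ _ hq, Nat.div_eq_of_lt (by omega), zero_add]
  rw [h3] at h2
  exact hm' (Nat.modEq_zero_iff_dvd.1 h2)

/-- If `p` divides `C(n, b)` for all `0 < b < R`, then `R` is at most a power of `p` that
divides `n`. -/
theorem exists_pow_dvd_of_choose {p : ℕ} [Fact p.Prime] {n R : ℕ} (hn : 1 ≤ n)
    (h : ∀ b, 1 ≤ b → b < R → p ∣ n.choose b) : ∃ s, p ^ s ∣ n ∧ R ≤ p ^ s := by
  have hp : p.Prime := Fact.out
  obtain ⟨s, m', hm', rfl⟩ := Nat.exists_eq_pow_mul_and_not_dvd (n := n) (by omega) p hp.ne_one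
  have hq : 0 < p ^ s := pow_pos hp.pos s
  refine ⟨s, Dvd.intro _ rfl, ?_⟩
  by_contra hR
  have h1 := (Nat.modEq_zero_iff_dvd.2 (h (p ^ s) hq (by omega)))
  have h2 := (choose_prime_pow_modEq (p ^ s * m') s).symm.trans h1
  rw [Nat.mul_div_cancel_left _ hq] at h2
  exact hm' (Nat.modEq_zero_iff_dvd.1 h2)

/-- The inner entries of row `p ^ t` vanish, so by Pascal's rule those of row `p ^ t - 1` alternate
between `1` and `-1`. -/
theorem neg_one_pow_mul_choose_pow_sub_one {F : Type*} [Field F] {p : ℕ} [Fact p.Prime] [CharP F p]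
    (t j : ℕ) (hj : j < p ^ t) :
    (-1 : F) ^ j * ((p ^ t - 1).choose j : F) = 1 := by
  have hp : p.Prime := Fact.out
  induction j with
  | zero => simp
  | succ j ih =>
    have h1 := ih (by omega)
    have h2 : ((p ^ t).choose (j + 1) : F) = 0 :=
      (CharP.cast_eq_zero_iff F p _).2 (hp.dvd_choose_pow (by omega) (by omega))
    have h3 : (p ^ t).choose (j + 1) = (p ^ t - 1).choose j + (p ^ t - 1).choose (j + 1) := by
      conv_lhs => rw [show p ^ t = (p ^ t - 1) + 1 by omega]
      rw [Nat.choose_succ_succ]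
    rw [h3] at h2
    push_cast at h2
    rw [pow_succ]
    linear_combination h1 - (-1 : F) ^ j * h2

/-- A power of `p` which is less than `2 p^t` divides `p^t`. -/
theorem pow_le_of_lt_two_mul {p s t : ℕ} (hp : 2 ≤ p) (h : p ^ s < 2 * p ^ t) : s ≤ t := by
  by_contra hst
  have h1 : p ^ (t + 1) ≤ p ^ s := Nat.pow_le_pow_right (by omega) (by omega)
  rw [pow_succ] at h1
  nlinarith [pow_pos (show 0 < p by omega) t]

theorem two_ne_zero_of_odd {F : Type*} [Field F] {p : ℕ} [Fact p.Prime] [CharP F p] (hp2 : p ≠ 2) :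
    (2 : F) ≠ 0 := by
  intro h0
  have h1 : ((2 : ℕ) : F) = 0 := by exact_mod_cast h0
  rw [CharP.cast_eq_zero_iff F p] at h1
  exact hp2 ((Nat.prime_dvd_prime_iff_eq Fact.out Nat.prime_two).1 h1)

end Binomial

/-! ### Structure constants -/

section Constants

variable {F : Type*} [Field F]

/-- The relations between the structure constants `ν` of an algebra of maximal class with two
distinct two-step centralizers, with respect to the basis `v₁ = y`, `v_{i+1} = [v_i, x + y]`.
Here `y` and `x` span the first and the second two-step centralizer, and `S i` means that `x`
centralizes `v_i`. -/
structure IsConstantSystem (S : ℕ → Prop) (ν : ℕ → ℕ → F) : Prop where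
  skew : ∀ {i j}, 1 ≤ i → 1 ≤ j → ν i j = -ν j i
  not_two : ¬ S 2
  one_of : ∀ {i}, 1 ≤ i → S i → ν i 1 = 1
  one_of_not : ∀ {i}, 1 ≤ i → ¬ S i → ν i 1 = 0
  succ : ∀ {i j}, 1 ≤ i → 1 ≤ j → ν i (j + 1) = ν i j - ν (i + 1) j
  nns : ∀ {i j}, 1 ≤ i → 1 ≤ j → ¬ S i → ¬ S j → S (i + j) → ν i j = 0
  snn : ∀ {i j}, 1 ≤ i → 1 ≤ j → S i → ¬ S j → ¬ S (i + j) → ν (i + 1) j = 0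
  sns : ∀ {i j}, 1 ≤ i → 1 ≤ j → S i → ¬ S j → S (i + j) → ν i j = ν (i + 1) j
  ssn : ∀ {i j}, 1 ≤ i → 1 ≤ j → S i → S j → ¬ S (i + j) → ν i j = 0
  nss : ∀ {i j}, 1 ≤ i → 1 ≤ j → ¬ S i → S j → S (i + j) → ν (i + 1) j = 0
  nsn : ∀ {i j}, 1 ≤ i → 1 ≤ j → ¬ S i → S j → ¬ S (i + j) → ν (i + 1) j = ν i j

/-- `S u` is followed by `S (u + m)`, with nothing in between. -/
structure Gap (S : ℕ → Prop) (u m : ℕ) : Prop where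
  start : S u
  pos : 1 ≤ m
  last : S (u + m)
  inner : ∀ j, 1 ≤ j → j < m → ¬ S (u + j)

namespace IsConstantSystem

variable {S : ℕ → Prop} {ν : ℕ → ℕ → F}

/-- Raising the second index is a backward difference in the first one; this is its `k`-th iterate.
With `l = 1` it expresses `ν` through the indicator of `S`. -/
theorem apply_add (h : IsConstantSystem S ν) {i l : ℕ} (hi : 1 ≤ i) (hl : 1 ≤ l) (k : ℕ) :
    ν i (l + k) = ∑ j ∈ Finset.range (k + 1), (-1) ^ j * (k.choose j : F) * ν (i + j) l := by
  induction k generalizing i with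
  | zero => simp
  | succ k ih =>
    rw [← add_assoc, h.succ hi (by omega), ih hi, ih (by omega), Finset.sum_range_succ' _ (k + 1),
      Finset.sum_range_succ' _ k]
    have h1 : ∑ j ∈ Finset.range (k + 1),
        (-1 : F) ^ (j + 1) * ((k + 1).choose (j + 1) : F) * ν (i + (j + 1)) l =
        ∑ j ∈ Finset.range (k + 1), (-1 : F) ^ (j + 1) * (k.choose (j + 1) : F) * ν (i + (j + 1)) l
        - ∑ j ∈ Finset.range (k + 1), (-1 : F) ^ j * (k.choose j : F) * ν (i + 1 + j) l := by
      rw [← Finset.sum_sub_distrib]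
      refine Finset.sum_congr rfl fun j _ => ?_
      rw [Nat.choose_succ_succ, show i + 1 + j = i + (j + 1) by ring]
      push_cast
      ring
    have h2 : ∑ j ∈ Finset.range (k + 1), (-1 : F) ^ (j + 1) * (k.choose (j + 1) : F) *
        ν (i + (j + 1)) l =
        ∑ j ∈ Finset.range k, (-1 : F) ^ (j + 1) * (k.choose (j + 1) : F) * ν (i + (j + 1)) l := by
      rw [Finset.sum_range_succ, Nat.choose_succ_self]
      simp
    rw [h1, h2]
    simp only [pow_zero, Nat.choose_zero_right]
    ring

/-- If only `S (i + a)` holds among `S (i + j)`, `j ≤ k`, then `ν i (k + 1)` is a signed binomial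
coefficient. -/
theorem apply_succ_of_unique (h : IsConstantSystem S ν) {i k a : ℕ} (hi : 1 ≤ i) (ha : a ≤ k)
    (hS : S (i + a)) (hn : ∀ j ≤ k, j ≠ a → ¬ S (i + j)) :
    ν i (k + 1) = (-1) ^ a * (k.choose a : F) := by
  rw [add_comm, h.apply_add hi le_rfl, Finset.sum_eq_single a, h.one_of (by omega) hS, mul_one]
  · intro j hj hja
    rw [h.one_of_not (by omega) (hn j (by simpa [Nat.lt_succ_iff] using hj) hja), mul_zero]
  · intro hk
    exact absurd (Finset.mem_range.2 (by omega)) hk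

theorem apply_succ_of_none (h : IsConstantSystem S ν) {i k : ℕ} (hi : 1 ≤ i)
    (hn : ∀ j ≤ k, ¬ S (i + j)) : ν i (k + 1) = 0 := by
  rw [add_comm, h.apply_add hi le_rfl]
  refine Finset.sum_eq_zero fun j hj => ?_
  rw [h.one_of_not (by omega) (hn j (by simpa [Nat.lt_succ_iff] using hj)), mul_zero]

/-! Differences of sequences which are constant up to one or two terms. -/

theorem add_of_const (h : IsConstantSystem S ν) {i l b : ℕ} {c : F} (hi : 1 ≤ i) (hl : 1 ≤ l)
    (hb : 1 ≤ b) (hc : ∀ j ≤ b, ν (i + j) l = c) : ν i (l + b) = 0 := by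
  induction b, hb using Nat.le_induction generalizing i with
  | base => rw [h.succ hi hl, hc 1 le_rfl, show ν i l = c from hc 0 (by omega), sub_self]
  | succ b hb ih =>
    rw [← add_assoc, h.succ hi (by omega), ih hi fun j hj => hc j (by omega),
      ih (by omega) fun j hj => by rw [add_assoc, hc (1 + j) (by omega)], sub_zero]

theorem add_of_const_tail (h : IsConstantSystem S ν) {i l b : ℕ} {c : F} (hi : 1 ≤ i) (hl : 1 ≤ l)
    (hb : 1 ≤ b) (hc : ∀ j, 1 ≤ j → j ≤ b → ν (i + j) l = c) : ν i (l + b) = ν i l - c := by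
  induction b, hb using Nat.le_induction with
  | base => rw [h.succ hi hl, hc 1 le_rfl le_rfl]
  | succ b hb ih =>
    rw [← add_assoc, h.succ hi (by omega), ih fun j h1 hj => hc j h1 (by omega),
      h.add_of_const (by omega) hl hb (fun j hj => by
        rw [add_assoc, hc (1 + j) (by omega) (by omega)]), sub_zero]

theorem add_of_const_init (h : IsConstantSystem S ν) {i l b : ℕ} {c d : F} (hi : 1 ≤ i)
    (hl : 1 ≤ l) (hb : 1 ≤ b) (hc : ∀ j < b, ν (i + j) l = c) (hd : ν (i + b) l = d) :
    ν i (l + b) = (-1) ^ b * (d - c) := by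
  induction b, hb using Nat.le_induction generalizing i with
  | base =>
    rw [h.succ hi hl, hd, show ν i l = c from hc 0 (by omega)]
    ring
  | succ b hb ih =>
    rw [← add_assoc, h.succ hi (by omega),
      h.add_of_const hi hl hb (fun j hj => hc j (by omega)),
      ih (by omega) (fun j hj => by rw [add_assoc, hc (1 + j) (by omega)])
        (by rw [← hd]; congr 1; ring)]
    ring

/-- Differences of order a power of `p`. -/
theorem add_pow (h : IsConstantSystem S ν) {p : ℕ} [Fact p.Prime] [CharP F p] (hp2 : p ≠ 2)
    {i l : ℕ} (hi : 1 ≤ i) (hl : 1 ≤ l) (t : ℕ) :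
    ν i (l + p ^ t) = ν i l - ν (i + p ^ t) l := by
  have hp : p.Prime := Fact.out
  have hq : 0 < p ^ t := pow_pos hp.pos t
  have hodd : Odd (p ^ t) := (hp.odd_of_ne_two hp2).pow
  rw [h.apply_add hi hl, Finset.sum_range_succ, Finset.sum_eq_single 0]
  · simp [hodd.neg_one_pow]
    ring
  · intro j hj hj0
    rw [(CharP.cast_eq_zero_iff F p _).2 (hp.dvd_choose_pow (by simpa using hj0)
      (by simp at hj; omega))]
    ring
  · exact fun h0 => absurd (Finset.mem_range.2 hq) h0

/-- All signed entries of row `p ^ t - 1` equal `1`, so the position of the single element of `S` in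
the window is irrelevant. -/
theorem pow_eq_one (h : IsConstantSystem S ν) {p : ℕ} [Fact p.Prime] [CharP F p]
    {i a t : ℕ} (hi : 1 ≤ i) (ha : a < p ^ t) (hS : S (i + a))
    (hn : ∀ j < p ^ t, j ≠ a → ¬ S (i + j)) : ν i (p ^ t) = 1 := by
  obtain ⟨k, hk⟩ : ∃ k, p ^ t = k + 1 := ⟨p ^ t - 1, by omega⟩
  have h1 := h.apply_succ_of_unique (k := k) hi (by omega) hS fun j hj => hn j (by omega)
  have h2 := neg_one_pow_mul_choose_pow_sub_one (F := F) t a ha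
  rw [hk, Nat.add_sub_cancel] at h2
  rw [hk, h1, h2]

theorem pow_eq_zero (h : IsConstantSystem S ν) {q : ℕ} (hq : 1 ≤ q)
    {i : ℕ} (hi : 1 ≤ i) (hn : ∀ j < q, ¬ S (i + j)) : ν i q = 0 := by
  obtain ⟨k, rfl⟩ : ∃ k, q = k + 1 := ⟨q - 1, by omega⟩
  exact h.apply_succ_of_none hi fun j hj => hn j (by omega)

/-! ### Lengths of constituents -/

section Lengths

variable {n : ℕ} (hn1 : 1 ≤ n) (hn : S n) (hmin : ∀ j, 1 ≤ j → j < n → ¬ S j)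
include hn1 hn hmin

/-- If `n = 2a + 1`, the diagonal constant `ν (a + 1) (a + 1)` would be `±1`, against skew-symmetry.
-/
theorem even_first (h : IsConstantSystem S ν) (h2 : (2 : F) ≠ 0) : Even n := by
  by_contra hne
  obtain ⟨a, ha⟩ := Nat.not_even_iff_odd.1 hne
  have h1 : ν (a + 1) (a + 1) = (-1) ^ a * (a.choose a : F) :=
    h.apply_succ_of_unique (by omega) le_rfl (by convert hn using 1; omega)
      fun j hj hja => hmin _ (by omega) (by omega)
  have h3 := h.skew (i := a + 1) (j := a + 1) (by omega) (by omega)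
  have h4 : (2 : F) * ν (a + 1) (a + 1) = 0 := by linear_combination h3
  rw [h1, Nat.choose_self] at h4
  simp [h2] at h4

/-- Otherwise `ν u n` is `1` by its binomial formula, and `0` because both `v_u` and `v_n` are
centralized by `x` while `v_{u+n}` is not. -/
theorem exists_gap (h : IsConstantSystem S ν) {u : ℕ} (hu1 : 1 ≤ u) (hu : S u) :
    ∃ m ≤ n, Gap S u m := by
  classical
  have hex : ∃ m, 1 ≤ m ∧ m ≤ n ∧ S (u + m) := by
    by_contra! hno
    obtain ⟨k, rfl⟩ : ∃ k, n = k + 1 := ⟨n - 1, by omega⟩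
    have h1 : ν u (k + 1) = (-1) ^ 0 * (k.choose 0 : F) :=
      h.apply_succ_of_unique hu1 (by omega) hu fun j hj hj0 => hno j (by omega) (by omega)
    rw [h.ssn hu1 hn1 hu hn (hno _ (by omega) le_rfl)] at h1
    simp at h1
  refine ⟨Nat.find hex, (Nat.find_spec hex).2.1, hu, (Nat.find_spec hex).1,
    (Nat.find_spec hex).2.2, fun j h1 hj hS => ?_⟩
  exact Nat.find_min hex hj ⟨h1, hj.le.trans (Nat.find_spec hex).2.1, hS⟩

omit hn1 hn in
-- The bracket of `v_{u-a}` and `v_{m+a}` sees only `u` in its window, which gives the binomial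
-- coefficient. Both factors commute with `y`, but `v_{u+m}` does not, so the bracket is zero.
theorem dvd_choose_of_gap (h : IsConstantSystem S ν) {p : ℕ} [CharP F p] {u m A a : ℕ}
    (hg : Gap S u m) (hA : A < u) (hprev : ∀ a, 1 ≤ a → a ≤ A → ¬ S (u - a)) (ha1 : 1 ≤ a)
    (haA : a ≤ A) (ham : m + a < n) : p ∣ (m - 1 + a).choose a := by
  have hm := hg.pos
  have h1 : ν (u - a) (m - 1 + a + 1) = (-1) ^ a * ((m - 1 + a).choose a : F) := by
    refine h.apply_succ_of_unique (by omega) (by omega)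
      (by rw [Nat.sub_add_cancel (by omega)]; exact hg.start) fun j hj hja => ?_
    rcases lt_or_gt_of_ne hja with hlt | hgt
    · rw [show u - a + j = u - (a - j) by omega]
      exact hprev _ (by omega) (by omega)
    · rw [show u - a + j = u + (j - a) by omega]
      exact hg.inner _ (by omega) (by omega)
  rw [h.nns (by omega) (by omega) (hprev a ha1 haA) (hmin _ (by omega) (by omega))
    (by rw [show u - a + (m - 1 + a + 1) = u + m by omega]; exact hg.last)] at h1
  rw [← CharP.cast_eq_zero_iff F p]
  simpa using h1.symm

/-- For `l ≤ m` both `ν n l` and `ν l n` have a window that meets `S` only in `n`. Skew-symmetry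
thus determines row `n - 1` of Pascal's triangle modulo `p`, and adding neighbouring entries gives
row `n`. -/
theorem dvd_choose_first (h : IsConstantSystem S ν) {p : ℕ} [CharP F p] (h2 : (2 : F) ≠ 0) {m b : ℕ}
    (hg : Gap S n m) (hmn : m ≤ n) (hb1 : 1 ≤ b) (hb : b < m) : p ∣ n.choose b := by
  have heven := h.even_first hn1 hn hmin h2
  have key : ∀ l, 1 ≤ l → l ≤ m → (-1 : F) ^ l * ((n - 1).choose (l - 1) : F) = -1 := by
    intro l hl1 hl
    have h1 : ν n (l - 1 + 1) = (-1) ^ 0 * ((l - 1).choose 0 : F) :=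
      h.apply_succ_of_unique hn1 (by omega) hn fun j hj hj0 => hg.inner _ (by omega) (by omega)
    have h3 : ν l (n - 1 + 1) = (-1) ^ (n - l) * ((n - 1).choose (n - l) : F) := by
      refine h.apply_succ_of_unique hl1 (by omega) (by convert hn using 1; omega) fun j hj hja => ?_
      rcases lt_or_gt_of_ne hja with hlt | hgt
      · exact hmin _ (by omega) (by omega)
      · rw [show l + j = n + (l + j - n) by omega]
        exact hg.inner _ (by omega) (by omega)
    rw [Nat.sub_add_cancel hl1] at h1
    rw [Nat.sub_add_cancel hn1, h.skew hl1 hn1, h1] at h3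
    have h4 : (n - 1).choose (n - l) = (n - 1).choose (l - 1) :=
      Nat.choose_symm_of_eq_add (by omega)
    have h5 : (-1 : F) ^ (n - l) = (-1) ^ l := by
      have h6 : (-1 : F) ^ (n - l) * (-1) ^ l = 1 := by
        rw [← pow_add, Nat.sub_add_cancel (by omega), heven.neg_one_pow]
      have h7 : ((-1 : F) ^ l) * (-1) ^ l = 1 := by rw [← mul_pow]; simp
      exact mul_right_cancel₀ (pow_ne_zero l (neg_ne_zero.2 one_ne_zero)) (h6.trans h7.symm)
    rw [h4, h5] at h3
    simp at h3
    rw [← h3]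
  have h1 := key b hb1 hb.le
  have h3 := key (b + 1) (by omega) hb
  rw [Nat.add_sub_cancel] at h3
  have h4 : n.choose b = (n - 1).choose (b - 1) + (n - 1).choose b := by
    obtain ⟨n', rfl⟩ : ∃ n', n = n' + 1 := ⟨n - 1, by omega⟩
    obtain ⟨b', rfl⟩ : ∃ b', b = b' + 1 := ⟨b - 1, by omega⟩
    rw [Nat.choose_succ_succ]; rfl
  rw [← CharP.cast_eq_zero_iff F p, h4]
  push_cast
  have h5 : (-1 : F) ^ b * (((n - 1).choose (b - 1) : F) + ((n - 1).choose b : F)) = 0 := by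
    rw [pow_succ] at h3
    linear_combination h1 - h3
  rcases mul_eq_zero.1 h5 with h6 | h6
  · exact absurd h6 (pow_ne_zero _ (neg_ne_zero.2 one_ne_zero))
  · exact h6

/-- The first constituent has length `2 q`, where `q` is a power of `p`, and the second constituent
is short. -/
theorem exists_parameter (h : IsConstantSystem S ν) {p : ℕ} [Fact p.Prime] [CharP F p]
    (hp2 : p ≠ 2) : ∃ t, 1 ≤ t ∧ n = 2 * p ^ t ∧ Gap S n (p ^ t) := by
  have hp : p.Prime := Fact.out
  have hpodd := hp.odd_of_ne_two hp2
  have h2 : (2 : F) ≠ 0 := two_ne_zero_of_odd hp2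
  have heven := h.even_first hn1 hn hmin h2
  obtain ⟨m, hmn, hg⟩ := h.exists_gap hn1 hn hmin hn1 hn
  have hm := hg.pos
  obtain ⟨t, ht, hmt⟩ := exists_pow_dvd_of_choose (p := p) (R := m) hn1
    fun b hb1 hb => h.dvd_choose_first hn1 hn hmin h2 hg hmn hb1 hb
  have h2t : 2 * p ^ t ∣ n :=
    (Nat.coprime_two_left.2 hpodd.pow).mul_dvd_of_dvd_of_dvd heven.two_dvd ht
  have h2n := Nat.le_of_dvd (by omega) h2t
  obtain ⟨s, hs, hms⟩ := exists_pow_dvd_of_choose_add (p := p) (m := m) (R := n - m) hm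
    fun a ha1 ha => h.dvd_choose_of_gap hmin hg (A := n - 1) (by omega)
      (fun a h1 h3 => hmin _ (by omega) (by omega)) ha1 (by omega) (by omega)
  have hsm := Nat.le_of_dvd (by omega) hs
  -- Here `n ≤ m + p ^ s ≤ 2 m ≤ 2 p ^ t ≤ n`, so all of these are equalities.
  obtain rfl : m = p ^ t := by omega
  refine ⟨t, ?_, by omega, hg⟩
  by_contra ht0
  obtain rfl : t = 0 := by omega
  have : n = 2 := by simp at *; omega
  exact h.not_two (this ▸ hn)

/-- The lengths of the constituents. -/
theorem gap_length (h : IsConstantSystem S ν) {p t : ℕ} [Fact p.Prime] [CharP F p]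
    (hnt : n = 2 * p ^ t) {u m : ℕ} (hu1 : 1 ≤ u) (hg : Gap S u m) :
    p ^ t ≤ m ∧ (m = 2 * p ^ t ∨ ∃ s ≤ t, m + p ^ s = 2 * p ^ t) := by
  classical
  have hp : p.Prime := Fact.out
  have hq : 0 < p ^ t := pow_pos hp.pos t
  induction u using Nat.strong_induction_on generalizing m with
  | _ u ih =>
    have hm := hg.pos
    have hmn : m ≤ n := by
      obtain ⟨m', hm', hg'⟩ := h.exists_gap hn1 hn hmin hu1 hg.start
      by_contra hlt
      exact hg.inner m' hg'.pos (by omega) hg'.last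
    have hnu : n ≤ u := by
      by_contra hlt
      exact hmin u hu1 (by omega) hg.start
    -- By induction the constituent that ends at `u` is not shorter than `p ^ t`.
    have hprev : ∀ a, 1 ≤ a → a ≤ p ^ t - 1 → ¬ S (u - a) := by
      intro a ha1 ha hS
      rcases lt_or_ge (u - a) n with hlt | hge
      · exact hmin _ (by omega) hlt hS
      obtain ⟨m', hm', hg'⟩ := h.exists_gap hn1 hn hmin (by omega) hS
      have h1 := (ih (u - a) (by omega) (by omega) hg').1
      exact hg'.inner a ha1 (by omega) (by rw [Nat.sub_add_cancel (by omega)]; exact hg.start)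
    obtain ⟨s, hs, hms⟩ := exists_pow_dvd_of_choose_add (p := p) (m := m)
      (R := min (p ^ t) (n - m)) hm
      fun a ha1 ha => h.dvd_choose_of_gap hmin hg (A := p ^ t - 1) (by omega)
        hprev ha1 (by omega) (by omega)
    have hsm := Nat.le_of_dvd (by omega) hs
    -- If `m < q`, then `n - m > q`, and the minimum `q` would be at most `p ^ s ≤ m`.
    have hmq : p ^ t ≤ m := by omega
    refine ⟨hmq, ?_⟩
    rcases eq_or_lt_of_le hmn with heq | hlt
    · exact Or.inl (by omega)
    right
    have hst : s ≤ t := pow_le_of_lt_two_mul hp.two_le (by omega)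
    refine ⟨s, hst, ?_⟩
    have h1 : p ^ s ∣ 2 * p ^ t := (pow_dvd_pow p hst).mul_left 2
    have h3 := (Nat.dvd_sub h1 hs)
    have h4 := Nat.le_of_dvd (by omega) h3
    omega

end Lengths

end IsConstantSystem

end Constants

/-! ### Excluding constituents of other lengths -/

section Constants

variable {F : Type*} [Field F]

namespace IsConstantSystem

variable {S : ℕ → Prop} {ν : ℕ → ℕ → F}

/-! ### Excluding constituents which are neither short nor long -/

/-- As `x` commutes with `v_l`, `ad x` carries one bracket with `v_l` to the next as long as `x`
acts as the shift on both sides. This transports constants across the interior of a constituent. -/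
theorem chain (h : IsConstantSystem S ν) {i l b : ℕ} (hi : 1 ≤ i) (hl : 1 ≤ l) (hS : S l)
    (h1 : ∀ j < b, ¬ S (i + j)) (h2 : ∀ j < b, ¬ S (i + j + l)) : ν (i + b) l = ν i l := by
  induction b with
  | zero => rfl
  | succ b ih =>
    rw [← add_assoc, h.nsn (by omega) hl (h1 b (by omega)) hS (h2 b (by omega))]
    exact ih (fun j hj => h1 j (by omega)) fun j hj => h2 j (by omega)

theorem add_two_mul (h : IsConstantSystem S ν) {p : ℕ} [Fact p.Prime] [CharP F p] (hp2 : p ≠ 2)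
    {i : ℕ} (hi : 1 ≤ i) (t : ℕ) : ν i (2 * p ^ t) = ν i (p ^ t) - ν (i + p ^ t) (p ^ t) := by
  rw [two_mul, h.add_pow hp2 hi (pow_pos (Fact.out : p.Prime).pos t)]

/-- Two constituents ending in `e` and `g`, the first one followed by a short constituent and the
second one by a long one. -/
theorem false_of_short_long (h : IsConstantSystem S ν) {p t m e g : ℕ} [Fact p.Prime] [CharP F p]
    (hp2 : p ≠ 2) (he1 : 1 ≤ e) (hg1 : 1 ≤ g) (hm1 : p ^ t < m) (hm2 : m < 2 * p ^ t) (hm : Odd m)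
    (he : S e) (heq : S (e + p ^ t)) (hen : ∀ j, 1 ≤ j → j < p ^ t → ¬ S (e + j))
    (hen' : ∀ j, 1 ≤ j → j < p ^ t → ¬ S (e + p ^ t + j)) (hg : S g) (hgm : ¬ S (g + m))
    (hgap : Gap S (e + g) m) (hν : ν (g + p ^ t) e = -1) : False := by
  have hq : Odd (p ^ t) := ((Fact.out : p.Prime).odd_of_ne_two hp2).pow
  set q := p ^ t with hqdef
  have hq0 : 1 ≤ q := by rcases hq with ⟨a, ha⟩; omega
  have hz : ν (e + q) g = 0 := by
    refine h.ssn (by omega) hg1 heq hg ?_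
    rw [show e + q + g = e + g + q by ring]
    exact hgap.inner q hq0 hm1
  have hz' : ∀ j, 1 ≤ j → j ≤ q → ν (e + j) g = 0 := by
    intro j hj1 hj
    rw [← hz]
    have := h.chain (i := e + j) (b := q - j) (by omega) hg1 hg
      (fun a ha => by rw [add_assoc]; exact hen _ (by omega) (by omega))
      (fun a ha => by
        rw [show e + j + a + g = e + g + (j + a) by ring]; exact hgap.inner _ (by omega) (by omega))
    rw [← this]; congr 1; omega
  have hone : ν e g = 1 := by
    have h1 := h.add_pow hp2 he1 hg1 t
    rw [← hqdef, hz, sub_zero, h.skew he1 (by omega), hν, neg_neg] at h1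
    exact h1.symm
  have hζ : ∀ j, 1 ≤ j → j ≤ m - q → ν (e + q + j) g = ν (e + q + 1) g := by
    intro j hj1 hj
    have := h.chain (i := e + q + 1) (b := j - 1) (by omega) hg1 hg
      (fun a ha => by rw [add_assoc]; exact hen' _ (by omega) (by omega))
      (fun a ha => by
        rw [show e + q + 1 + a + g = e + g + (q + 1 + a) by ring]
        exact hgap.inner _ (by omega) (by omega))
    rw [← this]; congr 1; omega
  have hend : ν (e + m + 1) g = 0 := by
    refine h.nss (by omega) hg1 ?_ hg ?_
    · rw [show e + m = e + q + (m - q) by omega]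
      exact hen' _ (by omega) (by omega)
    · rw [show e + m + g = e + g + m by ring]; exact hgap.last
  -- Now `ν e (g + m + 1)` is evaluated as a difference of order `b + 1`, then one of order `q`.
  -- Since `b` is even, the unknown `ζ = ν (e + q + 1) g` cancels and the value is `1`.
  obtain ⟨b, hb⟩ : ∃ b, m = q + b := ⟨m - q, by omega⟩
  have hbe : Even b := by
    rw [hb] at hm
    exact (Nat.odd_add.1 hm).1 hq
  have h1 : ν e (g + (b + 1)) = ν e g - 0 :=
    h.add_of_const_tail he1 hg1 (by omega) fun j hj1 hj => hz' j hj1 (by omega)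
  have h2 : ν (e + q) (g + b) = ν (e + q) g - ν (e + q + 1) g :=
    h.add_of_const_tail (by omega) hg1 (by omega) fun j hj1 hj => hζ j hj1 (by omega)
  have h3 : ν (e + q + 1) (g + b) = (-1) ^ b * (0 - ν (e + q + 1) g) :=
    h.add_of_const_init (by omega) hg1 (by omega)
      (fun j hj => by rw [add_assoc]; exact hζ _ (by omega) (by omega))
      (by rw [← hend]; congr 1; omega)
  have h4 : ν (e + q) (g + (b + 1)) = 0 := by
    rw [← add_assoc, h.succ (by omega) (by omega), h2, h3, hz, hbe.neg_one_pow]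
    ring
  have h5 : ν e (g + (b + 1) + q) = 1 := by
    rw [h.add_pow hp2 he1 (by omega) t, ← hqdef, h1, h4, hone]; ring
  -- The Jacobi identity with `y` makes the same constant `ν e (g + m + 1)` zero.
  have h6 : ν e (g + m) = ν (e + 1) (g + m) := by
    refine h.sns he1 (by omega) he hgm ?_
    rw [← add_assoc]; exact hgap.last
  have h7 := h.succ (i := e) (j := g + m) he1 (by omega)
  rw [h6, sub_self, show g + m + 1 = g + (b + 1) + q by omega, h5] at h7
  exact one_ne_zero h7

/-- Two constituents ending in `e` and `g`, both followed by a long constituent. -/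
theorem eq_two_of_long_long (h : IsConstantSystem S ν) {p t m e g : ℕ} [Fact p.Prime] [CharP F p]
    (hp2 : p ≠ 2) (he1 : 1 ≤ e) (hg1 : 1 ≤ g) (hm1 : p ^ t < m) (hm : Odd m)
    (he : S e) (hen : ∀ j, 1 ≤ j → j ≤ m → ¬ S (e + j)) (hg : S g) (hgm : ¬ S (g + m))
    (hgap : Gap S (e + g) m) (hν : ν (g + p ^ t) e = -1) : ν e g = 2 := by
  have hq : Odd (p ^ t) := ((Fact.out : p.Prime).odd_of_ne_two hp2).pow
  set q := p ^ t with hqdef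
  have hq0 : 1 ≤ q := by rcases hq with ⟨a, ha⟩; omega
  set c := ν (e + 1) g with hc
  have hconst : ∀ j, 1 ≤ j → j ≤ m → ν (e + j) g = c := by
    intro j hj1 hj
    have := h.chain (i := e + 1) (b := j - 1) (by omega) hg1 hg
      (fun a ha => by rw [add_assoc]; exact hen _ (by omega) (by omega))
      (fun a ha => by
        rw [show e + 1 + a + g = e + g + (1 + a) by ring]; exact hgap.inner _ (by omega) (by omega))
    rw [hc, ← this]; congr 1; omega
  have hend : ν (e + m + 1) g = 0 := by
    refine h.nss (by omega) hg1 (hen m (by omega) le_rfl) hg ?_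
    rw [show e + m + g = e + g + m by ring]; exact hgap.last
  have h1 : ν e g - c = 1 := by
    have h1 := h.add_of_const_tail he1 hg1 hq0 fun j hj1 hj => hconst j hj1 (by omega)
    rw [h.skew he1 (by omega), hν, neg_neg] at h1
    exact h1.symm
  have h2 : ν e (g + m) = ν e g - c :=
    h.add_of_const_tail he1 hg1 (by omega) hconst
  have h3 : ν (e + 1) (g + m) = (-1) ^ m * (0 - c) :=
    h.add_of_const_init (by omega) hg1 (by omega)
      (fun j hj => by rw [add_assoc]; exact hconst _ (by omega) (by omega))
      (by rw [← hend]; congr 1; omega)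
  have h6 : ν e (g + m) = ν (e + 1) (g + m) := by
    refine h.sns he1 (by omega) he hgm ?_
    rw [← add_assoc]; exact hgap.last
  rw [hm.neg_one_pow] at h3
  -- The relations read `ν e g - c = 1` and, because `m` is odd, `ν e g - c = c`.
  linear_combination 2 * h1 + h2 - h6 - h3

/-- The initial constituents `2q, q^r, 2q`, and the last constituents `2q, q^k` before one of
length `m`. -/
structure Pattern (S : ℕ → Prop) (q r k m g : ℕ) : Prop where
  one_le_q : 1 ≤ q
  lt_m : q < m
  m_lt : m < 2 * q
  one_le_g : 1 ≤ g
  start : ∀ l ≤ r, S ((l + 2) * q)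
  start_inner : ∀ l ≤ r, ∀ j, 1 ≤ j → j < q → ¬ S ((l + 2) * q + j)
  start_long : ∀ j, 1 ≤ j → j < 2 * q → ¬ S ((r + 2) * q + j)
  start_last : S ((r + 2) * q + 2 * q)
  long : S g
  long_inner : ∀ j, 1 ≤ j → j < 2 * q → ¬ S (g + j)
  short : ∀ a ≤ k, S (g + (a + 2) * q)
  short_inner : ∀ a ≤ k, ∀ j, 1 ≤ j → j < q → ¬ S (g + (a + 2) * q + j)
  gap : Gap S (g + (k + 2) * q) m

/-! ### Comparing the numbers `r` and `k` of short constituents -/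

namespace Pattern

variable {p t r k m g : ℕ} [Fact p.Prime] [CharP F p] (hP : Pattern S (p ^ t) r k m g)
  (h : IsConstantSystem S ν) (hp2 : p ≠ 2)

include hP h hp2

/-- The weight `g + q` is the middle of a long constituent. Passing from `(l + 2) q` to `(l + 3) q`
subtracts the constant at `g + 2q`, which is zero: it is transported from `g + q + 1`, where the sum
has just left an element of `S`. -/
theorem const_mid {l : ℕ} (hlk : l ≤ k) (hlr : l ≤ r + 1) :
    ν (g + p ^ t) ((l + 2) * p ^ t) = -1 := by
  have hq := hP.one_le_q
  have hg1 := hP.one_le_g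
  have hw0 : S (g + p ^ t + p ^ t) := by
    have := hP.short 0 (by omega); rwa [zero_add, two_mul, ← add_assoc] at this
  induction l with
  | zero =>
    rw [zero_add, h.add_two_mul hp2 (by omega), h.pow_eq_zero hq (by omega),
      h.pow_eq_one (i := g + p ^ t + p ^ t) (a := 0) (by omega) (by omega) hw0, zero_sub]
    · intro j hj hj0
      have := hP.short_inner 0 (by omega) j (by omega) hj
      rwa [zero_add, two_mul, ← add_assoc] at this
    · intro j hj
      rw [add_assoc]; exact hP.long_inner _ (by omega) (by omega)
  | succ l ih =>
    have hl := ih (by omega) (by omega)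
    have hS := hP.start l (by omega)
    have hl1 : 1 ≤ (l + 2) * p ^ t := Nat.mul_pos (by omega) hq
    have hsum : g + p ^ t + (l + 2) * p ^ t = g + (l + 1 + 2) * p ^ t := by ring
    have h1 : ν (g + p ^ t + 1) ((l + 2) * p ^ t) = 0 :=
      h.nss (by omega) hl1 (hP.long_inner _ hq (by omega)) hS
        (by rw [hsum]; exact hP.short _ hlk)
    have h2 := h.chain (i := g + p ^ t + 1) (b := p ^ t - 1) (by omega) hl1 hS
      (fun j hj => by rw [add_assoc, add_assoc]; exact hP.long_inner _ (by omega) (by omega))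
      (fun j hj => by
        have := hP.short_inner (l + 1) hlk (1 + j) (by omega) (by omega)
        rwa [← hsum, show g + p ^ t + (l + 2) * p ^ t + (1 + j) =
          g + p ^ t + 1 + j + (l + 2) * p ^ t by ring] at this)
    rw [show (l + 1 + 2) * p ^ t = (l + 2) * p ^ t + p ^ t by ring, h.add_pow hp2 (by omega) hl1,
      hl, show g + p ^ t + p ^ t = g + p ^ t + 1 + (p ^ t - 1) by omega, h2, h1, sub_zero]

/-- For larger `k`, bracket the middles `g + q` and `(r + 3) q` of two long constituents: both
commute with `y`, while the weight of the bracket lies in `S`, so the constant `-1` would be zero.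
-/
theorem k_le : k ≤ r + 1 := by
  by_contra hk
  have hq := hP.one_le_q
  have hE : ¬ S ((r + 1 + 2) * p ^ t) := by
    have := hP.start_long (p ^ t) hq (by omega)
    rwa [show (r + 2) * p ^ t + p ^ t = (r + 1 + 2) * p ^ t by ring] at this
  have h1 := hP.const_mid h hp2 (l := r + 1) (by omega) le_rfl
  rw [h.nns (by omega) (Nat.mul_pos (by omega) hq) (hP.long_inner _ hq (by omega)) hE] at h1
  · exact neg_ne_zero.2 one_ne_zero h1.symm
  · have := hP.short (r + 2) (by omega)
    rwa [show g + (r + 2 + 2) * p ^ t = g + p ^ t + (r + 1 + 2) * p ^ t by ring] at this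

/-- For `k < r`, the element of weight `(k + 2) q` is still followed by a short constituent, whereas
`g` is followed by a long one. -/
theorem r_le (hm : Odd m) : r ≤ k := by
  by_contra hk
  have hq := hP.one_le_q
  have hsum : (k + 2) * p ^ t + g = g + (k + 2) * p ^ t := by ring
  have hnext : (k + 2) * p ^ t + p ^ t = (k + 1 + 2) * p ^ t := by ring
  refine h.false_of_short_long hp2 (e := (k + 2) * p ^ t) (g := g) (m := m) (t := t)
    (Nat.mul_pos (by omega) hq) hP.one_le_g hP.lt_m hP.m_lt hm (hP.start k (by omega))
    ?_ (hP.start_inner k (by omega)) ?_ hP.long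
    (hP.long_inner m hP.gap.pos hP.m_lt) (by rw [hsum]; exact hP.gap)
    (hP.const_mid h hp2 le_rfl (by omega))
  · rw [hnext]; exact hP.start (k + 1) (by omega)
  · rw [hnext]; exact hP.start_inner (k + 1) (by omega)

/-- Each further difference of order `q` subtracts the value `-1` found at `g + q`. -/
theorem const_start {l : ℕ} (hlk : l ≤ k) (hlr : l ≤ r) :
    ν g ((l + 2) * p ^ t) = l + 1 := by
  have hq := hP.one_le_q
  have hg1 := hP.one_le_g
  induction l with
  | zero =>
    rw [zero_add, h.add_two_mul hp2 (by omega),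
      h.pow_eq_one (i := g) (a := 0) (by omega) (by omega) hP.long,
      h.pow_eq_zero hq (by omega)]
    · simp
    · intro j hj
      rw [add_assoc]; exact hP.long_inner _ (by omega) (by omega)
    · intro j hj hj0
      exact hP.long_inner _ (by omega) (by omega)
  | succ l ih =>
    have hl1 : 1 ≤ (l + 2) * p ^ t := Nat.mul_pos (by omega) hq
    rw [show (l + 1 + 2) * p ^ t = (l + 2) * p ^ t + p ^ t by ring, h.add_pow hp2 hg1 hl1,
      ih (by omega) (by omega), hP.const_mid h hp2 (by omega) (by omega)]
    push_cast
    ring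

/-- The recursion for a triangle of constants just after the elements `g + (a + 2) q` of `S`. The
next three lemmas fill its diagonals `a + l = k - 2`, `k - 1`, `k`, each from the preceding one. -/
theorem const_add {a l : ℕ} :
    ν (g + (a + 2) * p ^ t + 1) ((l + 1 + 2) * p ^ t) =
      ν (g + (a + 2) * p ^ t + 1) ((l + 2) * p ^ t) -
        ν (g + (a + 1 + 2) * p ^ t + 1) ((l + 2) * p ^ t) := by
  have hq := hP.one_le_q
  rw [show (l + 1 + 2) * p ^ t = (l + 2) * p ^ t + p ^ t by ring,
    h.add_pow hp2 (by omega) (Nat.mul_pos (by omega) hq)]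
  congr 2; ring

omit [Fact p.Prime] [CharP F p] hp2 in
theorem const_eq_zero {a l : ℕ} (hal : a + l + 2 = k) (hlr : l ≤ r) :
    ν (g + (a + 2) * p ^ t + 1) ((l + 2) * p ^ t) = 0 := by
  have hq := hP.one_le_q
  have hl1 : 1 ≤ (l + 2) * p ^ t := Nat.mul_pos (by omega) hq
  have hS := hP.start l hlr
  have hsum : g + (a + 2) * p ^ t + (l + 2) * p ^ t = g + (k + 2) * p ^ t := by
    rw [← hal]; ring
  rw [← h.chain (i := g + (a + 2) * p ^ t + 1) (b := p ^ t - 1) (by omega) hl1 hS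
      (fun j hj => by rw [add_assoc]; exact hP.short_inner a (by omega) _ (by omega) (by omega))
      (fun j hj => by
        have := hP.short_inner k le_rfl (1 + j) (by omega) (by omega)
        rwa [← hsum, show g + (a + 2) * p ^ t + (l + 2) * p ^ t + (1 + j) =
          g + (a + 2) * p ^ t + 1 + j + (l + 2) * p ^ t by ring] at this)]
  have h1 : g + (a + 2) * p ^ t + 1 + (p ^ t - 1) = g + (a + 1 + 2) * p ^ t := by
    rw [show (a + 1 + 2) * p ^ t = (a + 2) * p ^ t + p ^ t by ring]; omega
  -- After transport to the next element of `S`, both weights lie in `S`, but their sum is `q` past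
  -- the start of the gap of length `m > q`.
  rw [h1]
  refine h.ssn (by omega) hl1 (hP.short (a + 1) (by omega)) hS ?_
  have := hP.gap.inner (p ^ t) hq hP.lt_m
  rwa [← hsum, show g + (a + 2) * p ^ t + (l + 2) * p ^ t + p ^ t =
    g + (a + 1 + 2) * p ^ t + (l + 2) * p ^ t by ring] at this

theorem const_eq_sign {a l : ℕ} (hal : a + l + 1 = k) (hlr : l ≤ r) :
    ν (g + (a + 2) * p ^ t + 1) ((l + 2) * p ^ t) = (-1) ^ l := by
  have hq := hP.one_le_q
  induction l generalizing a with
  | zero =>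
    have hk : g + (a + 2) * p ^ t + p ^ t = g + (k + 2) * p ^ t := by rw [← hal]; ring
    have h1 := h.pow_eq_one (p := p) (t := t) (i := g + (a + 2) * p ^ t + 1) (a := p ^ t - 1)
      (by omega) (by omega)
      (by rw [show g + (a + 2) * p ^ t + 1 + (p ^ t - 1) = g + (a + 2) * p ^ t + p ^ t by omega, hk]
          exact hP.short k le_rfl)
      (fun j hj hj0 => by
        rw [add_assoc]; exact hP.short_inner a (by omega) _ (by omega) (by omega))
    have h2 := h.pow_eq_zero (q := p ^ t) (i := g + (a + 2) * p ^ t + 1 + p ^ t) hq (by omega)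
      (fun j hj => by
        rw [show g + (a + 2) * p ^ t + 1 + p ^ t + j =
          g + (a + 2) * p ^ t + p ^ t + (1 + j) by ring, hk]
        exact hP.gap.inner _ (by omega) (by have := hP.lt_m; omega))
    rw [zero_add, h.add_two_mul hp2 (by omega), h1, h2]
    simp
  | succ l ih =>
    rw [hP.const_add h hp2, hP.const_eq_zero h (by omega) (by omega),
      ih (a := a + 1) (by omega) (by omega)]
    ring

theorem const_eq_natCast (hnext : ∀ j, 1 ≤ j → j < p ^ t → ¬ S (g + (k + 2) * p ^ t + m + j))
    {a l : ℕ} (hal : a + l = k) (hlr : l ≤ r) :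
    ν (g + (a + 2) * p ^ t + 1) ((l + 2) * p ^ t) = (-1) ^ (l + 1) * (l + 1) := by
  have hq := hP.one_le_q
  have hm1 := hP.lt_m
  have hm2 := hP.m_lt
  induction l generalizing a with
  | zero =>
    obtain rfl : a = k := by omega
    have h1 := h.pow_eq_zero (q := p ^ t) (i := g + (a + 2) * p ^ t + 1) hq (by omega)
      (fun j hj => by rw [add_assoc]; exact hP.gap.inner _ (by omega) (by omega))
    -- Because `q < m < 2q`, the end of the exceptional gap lies in the second window of length `q`;
    -- `hnext` keeps it alone there.
    have h2 := h.pow_eq_one (p := p) (t := t) (i := g + (a + 2) * p ^ t + 1 + p ^ t)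
      (a := m - p ^ t - 1) (by omega) (by omega)
      (by rw [show g + (a + 2) * p ^ t + 1 + p ^ t + (m - p ^ t - 1) = g + (a + 2) * p ^ t + m by
            omega]
          exact hP.gap.last)
      (fun j hj hj0 => by
        rcases lt_or_ge (1 + p ^ t + j) m with hlt | hge
        · rw [show g + (a + 2) * p ^ t + 1 + p ^ t + j =
            g + (a + 2) * p ^ t + (1 + p ^ t + j) by ring]
          exact hP.gap.inner _ (by omega) hlt
        · rw [show g + (a + 2) * p ^ t + 1 + p ^ t + j =
            g + (a + 2) * p ^ t + m + (1 + p ^ t + j - m) by omega]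
          exact hnext _ (by omega) (by omega))
    rw [zero_add, h.add_two_mul hp2 (by omega), h1, h2]
    simp
  | succ l ih =>
    rw [hP.const_add h hp2, hP.const_eq_sign h hp2 (by omega) (by omega),
      ih (a := a + 1) (by omega) (by omega)]
    push_cast
    ring

/-- Constants at pairs of weights with sum `(r + 4) q` alternate in sign. For even `r` one such pair
is diagonal, contradicting skew-symmetry. -/
theorem odd_r : Odd r := by
  by_contra hne
  obtain ⟨c, hc⟩ := Nat.not_odd_iff_even.1 hne
  have hq := hP.one_le_q
  have key : ∀ l ≤ r, ν ((r - l + 2) * p ^ t) ((l + 2) * p ^ t) = (-1) ^ l := by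
    intro l hl
    induction l with
    | zero =>
      rw [zero_add, Nat.sub_zero, h.add_two_mul hp2 (Nat.mul_pos (by omega) hq),
        h.pow_eq_one (i := (r + 2) * p ^ t) (a := 0) (Nat.mul_pos (by omega) hq) (by omega)
          (hP.start r le_rfl), h.pow_eq_zero hq (by omega)]
      · simp
      · intro j hj
        rw [add_assoc]; exact hP.start_long _ (by omega) (by omega)
      · intro j hj hj0
        exact hP.start_long _ (by omega) (by omega)
    | succ l ih =>
      have hl1 : 1 ≤ (l + 2) * p ^ t := Nat.mul_pos (by omega) hq
      have hl2 : 1 ≤ (r - (l + 1) + 2) * p ^ t := Nat.mul_pos (by omega) hq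
      have h1 : ν ((r - (l + 1) + 2) * p ^ t) ((l + 2) * p ^ t) = 0 := by
        refine h.ssn hl2 hl1 (hP.start _ (by omega)) (hP.start _ (by omega)) ?_
        have := hP.start_long (p ^ t) hq (by omega)
        rwa [show (r + 2) * p ^ t + p ^ t = (r - (l + 1) + 2) * p ^ t + (l + 2) * p ^ t by
          rw [← add_mul, ← add_one_mul]; congr 1; omega] at this
      rw [show (l + 1 + 2) * p ^ t = (l + 2) * p ^ t + p ^ t by ring, h.add_pow hp2 hl2 hl1, h1,
        show (r - (l + 1) + 2) * p ^ t + p ^ t = (r - l + 2) * p ^ t by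
          rw [← add_one_mul]; congr 1; omega, ih (by omega)]
      ring
  have h1 := key c (by omega)
  have hpos : 1 ≤ (c + 2) * p ^ t := Nat.mul_pos (by omega) hq
  rw [show r - c = c by omega] at h1
  have h2 := h.skew hpos hpos
  rw [h1] at h2
  have h3 : (2 : F) * (-1) ^ c = 0 := by linear_combination h2
  rcases mul_eq_zero.1 h3 with h4 | h4
  · exact two_ne_zero_of_odd hp2 h4
  · exact pow_ne_zero _ (neg_ne_zero.2 one_ne_zero) h4

/-- With `e = (r + 2) q`, the bracket of `v_{g+q}` and `v_{e+m}` must vanish, as both weights are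
inside long constituents and the sum is in `S`. Reaching it by a difference of order `q` gives `-1 -
1` instead; the second `-1` uses that `r` is odd. -/
theorem k_ne : k ≠ r + 1 := by
  rintro rfl
  have hr := hP.odd_r h hp2
  have hq := hP.one_le_q
  have hm1 := hP.lt_m
  have hm2 := hP.m_lt
  have hg1 := hP.one_le_g
  set e := (r + 2) * p ^ t with he
  have he1 : 1 ≤ e := Nat.mul_pos (by omega) hq
  have hsum : g + (r + 1 + 2) * p ^ t = g + p ^ t + e := by rw [he]; ring
  have hw0S : S (g + 2 * p ^ t) := by simpa using hP.short 0 (by omega)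
  have hw0 : g + 2 * p ^ t = g + p ^ t + p ^ t := by ring
  have hgap := hP.gap
  rw [hsum] at hgap
  have hmid : ν (g + p ^ t) e = -1 := hP.const_mid h hp2 (l := r) (by omega) (by omega)
  have hz1 : ν (g + p ^ t + 1) e = 0 :=
    h.nss (by omega) he1 (hP.long_inner _ hq (by omega)) (hP.start r le_rfl) hgap.start
  have hz : ∀ j, 1 ≤ j → j ≤ p ^ t → ν (g + p ^ t + j) e = 0 := by
    intro j hj1 hj
    have := h.chain (i := g + p ^ t + 1) (b := j - 1) (by omega) he1 (hP.start r le_rfl)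
      (fun a ha => by rw [add_assoc, add_assoc]; exact hP.long_inner _ (by omega) (by omega))
      (fun a ha => by
        rw [show g + p ^ t + 1 + a + e = g + p ^ t + e + (1 + a) by ring]
        exact hgap.inner _ (by omega) (by omega))
    rw [← hz1, ← this]; congr 1; omega
  have hT : ν (g + 2 * p ^ t + 1) e = -1 := by
    have := hP.const_eq_sign h hp2 (a := 0) (l := r) (by omega) le_rfl
    rwa [zero_add, hr.neg_one_pow] at this
  set b := m - p ^ t with hb
  have hw : ν (g + p ^ t) (e + b) = -1 := by
    rw [h.add_of_const_tail (c := 0) (by omega) he1 (by omega)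
      (fun j hj1 hj => hz j hj1 (by omega)), hmid, sub_zero]
  have hw' : ∀ c, 1 ≤ c → c ≤ b → ν (g + 2 * p ^ t) (e + c) = 1 := by
    intro c hc1 hc
    induction c, hc1 using Nat.le_induction with
    | base => rw [h.succ (by omega) he1, hT, hw0, hz _ hq le_rfl]; ring
    | succ c hc1 ih =>
      rw [← add_assoc, h.succ (by omega) (by omega), ih (by omega),
        h.snn (by omega) (by omega) hw0S (hP.start_long c hc1 (by omega)), sub_zero]
      rw [show g + 2 * p ^ t + (e + c) = g + p ^ t + e + (p ^ t + c) by ring]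
      exact hgap.inner _ (by omega) (by omega)
  have h1 : ν (g + p ^ t) (e + b + p ^ t) = -2 := by
    rw [h.add_pow hp2 (by omega) (by omega), hw, ← hw0, hw' b (by omega) le_rfl]; ring
  rw [show e + b + p ^ t = e + m by omega,
    h.nns (by omega) (by omega) (hP.long_inner _ hq (by omega)) (hP.start_long m (by omega) hm2)
      (by rw [← add_assoc]; exact hgap.last)] at h1
  exact two_ne_zero_of_odd hp2 (by linear_combination h1)

/-- Comparing the two long constituents gives `k + 1 = -2` in `F`, hence `ρ ≠ 0`. Inside the
constituent after the bad one, each difference of order `q` adds `ρ` to `ν (g + q)`. A short next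
constituent then forces `ρ = 0`, and a longer one leaves room for two such steps and forces `2ρ =
0`. -/
theorem k_ne_of_next {s m' : ℕ} (hm : m + p ^ s = 2 * p ^ t)
    (hgap' : Gap S (g + (k + 2) * p ^ t + m) m') (hm' : m' = p ^ t ∨ p ^ t + p ^ s < m') : k ≠ r := by
  rintro rfl
  have hq := hP.one_le_q
  have hm1 := hP.lt_m
  have hm2 := hP.m_lt
  have hg1 := hP.one_le_g
  have hsodd : Odd (p ^ s) := ((Fact.out : p.Prime).odd_of_ne_two hp2).pow
  have hmodd : Odd m := by
    rcases hsodd with ⟨c, hc⟩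
    exact Nat.odd_iff.2 (by omega)
  have h2 : (2 : F) ≠ 0 := two_ne_zero_of_odd hp2
  set e := (k + 2) * p ^ t with he
  have he1 : 1 ≤ e := Nat.mul_pos (by omega) hq
  have hgap : Gap S (g + e) m := hP.gap
  have hw0S : S (g + 2 * p ^ t) := by simpa using hP.short 0 (by omega)
  have hw0 : g + 2 * p ^ t = g + p ^ t + p ^ t := by ring
  have hmid : ν (g + p ^ t) e = -1 := hP.const_mid h hp2 (l := k) le_rfl (by omega)
  have heg : ν e g = 2 := h.eq_two_of_long_long hp2 he1 hg1 hm1 hmodd (hP.start k le_rfl)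
    (fun j hj1 hj => hP.start_long j hj1 (by omega)) hP.long (hP.long_inner m (by omega) hm2)
    (by rw [add_comm]; exact hgap) hmid
  have hk : ((k : F) + 1) = -2 := by
    rw [← hP.const_start h hp2 le_rfl le_rfl, ← heg]
    exact h.skew hg1 he1
  have hρ := hP.const_eq_natCast h hp2 (a := 0) (l := k)
    (fun j hj1 hj => hgap'.inner j hj1 (by omega)) (by omega) le_rfl
  rw [zero_add, hk, ← he] at hρ
  set ρ := ν (g + 2 * p ^ t + 1) e with hρdef
  have hρ0 : ρ ≠ 0 := by
    rw [hρ]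
    exact mul_ne_zero (pow_ne_zero _ (neg_ne_zero.2 one_ne_zero)) (neg_ne_zero.2 h2)
  have hconst : ∀ j, j ≤ m - p ^ t → ν (g + p ^ t + j) e = -1 := by
    intro j hj
    rw [← hmid]
    exact h.chain (by omega) he1 (hP.start k le_rfl)
      (fun a ha => by rw [add_assoc]; exact hP.long_inner _ (by omega) (by omega))
      (fun a ha => by
        rw [show g + p ^ t + a + e = g + e + (p ^ t + a) by ring]
        exact hgap.inner _ (by omega) (by omega))
  have hz : ν (g + 2 * p ^ t) e = 0 := by
    have h1 : ν (g + m + 1) e = 0 :=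
      h.nss (by omega) he1 (hP.long_inner _ (by omega) hm2) (hP.start k le_rfl)
        (by rw [show g + m + e = g + e + m by ring]; exact hgap.last)
    have h3 := h.chain (i := g + m + 1) (b := p ^ s - 1) (by omega) he1 (hP.start k le_rfl)
      (fun a ha => by rw [add_assoc, add_assoc]; exact hP.long_inner _ (by omega) (by omega))
      (fun a ha => by
        rw [show g + m + 1 + a + e = g + e + m + (1 + a) by ring]
        exact hgap'.inner _ (by omega) (by omega))
    rw [h1] at h3
    rw [← h3]; congr 1; omega
  -- Since `g + 2q + e` lies `p ^ s` beyond the end of the bad gap, the sums stay inside the next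
  -- constituent while `c + p ^ s < m'`.
  have hw' : ∀ c, 1 ≤ c → c + p ^ s ≤ m' → c ≤ 2 * p ^ t → ν (g + 2 * p ^ t) (e + c) = -ρ := by
    intro c hc1 hc hc2
    induction c, hc1 using Nat.le_induction with
    | base => rw [h.succ (by omega) he1, hz, zero_sub]
    | succ c hc1 ih =>
      rw [← add_assoc, h.succ (by omega) (by omega), ih (by omega) (by omega),
        h.snn (by omega) (by omega) hw0S (hP.start_long c hc1 (by omega)), sub_zero]
      rw [show g + 2 * p ^ t + (e + c) = g + e + m + (p ^ s + c) by omega]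
      exact hgap'.inner _ (by omega) (by omega)
  have hadd : ∀ c, 1 ≤ c → c + p ^ s ≤ m' → c ≤ 2 * p ^ t →
      ν (g + p ^ t) (e + c + p ^ t) = ν (g + p ^ t) (e + c) + ρ := by
    intro c hc1 hc hc2
    rw [h.add_pow hp2 (by omega) (by omega), ← hw0, hw' c hc1 hc hc2]; ring
  have hwz : ∀ c, 1 ≤ c → c ≤ m - p ^ t → ν (g + p ^ t) (e + c) = 0 := fun c hc1 hc =>
    h.add_of_const (by omega) he1 hc1 fun j hj => hconst j (by omega)
  rcases hm' with hm' | hm'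
  · have h1 := hadd (m - p ^ t) (by omega) (by omega) (by omega)
    rw [hwz _ (by omega) le_rfl, show e + (m - p ^ t) + p ^ t = e + m by omega,
      h.nns (by omega) (by omega) (hP.long_inner _ hq (by omega)) (hP.start_long m (by omega) hm2)
        (by
          have := hgap'.last
          rwa [hm', show g + e + m + p ^ t = g + p ^ t + (e + m) by ring] at this), zero_add] at h1
    exact hρ0 h1.symm
  · have h1 := hadd 1 le_rfl (by omega) (by omega)
    have h3 := hadd (1 + p ^ t) (by omega) (by omega) (by omega)
    rw [← add_assoc, h1, hwz 1 le_rfl (by omega)] at h3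
    have h4 := h.nsn (i := g + p ^ t) (j := e + 2 * p ^ t) (by omega) (by omega)
      (hP.long_inner _ hq (by omega)) hP.start_last
      (by
        rw [show g + p ^ t + (e + 2 * p ^ t) = g + e + m + (p ^ t + p ^ s) by omega]
        exact hgap'.inner _ (by omega) hm')
    have h5 := h.succ (i := g + p ^ t) (j := e + 2 * p ^ t) (by omega) (by omega)
    rw [h4, sub_self, show e + 2 * p ^ t + 1 = e + 1 + p ^ t + p ^ t by ring, h3] at h5
    exact hρ0 ((mul_eq_zero.1 (show (2 : F) * ρ = 0 by linear_combination h5)).resolve_left h2)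

end Pattern

end IsConstantSystem

end Constants

/-! ### Every constituent is short or long -/

section Constants

variable {F : Type*} [Field F]

theorem Gap.unique {S : ℕ → Prop} {u m m' : ℕ} (h : Gap S u m) (h' : Gap S u m') : m = m' := by
  rcases lt_trichotomy m m' with hlt | heq | hgt
  · exact absurd h.last (h'.inner m h.pos hlt)
  · exact heq
  · exact absurd h'.last (h.inner m' h'.pos hgt)

theorem Gap.le_of_lt {S : ℕ → Prop} {u m v : ℕ} (h : Gap S u m) (hv : S v) (huv : u < v) :
    u + m ≤ v := by
  by_contra hlt
  exact h.inner (v - u) (by omega) (by omega) (by rwa [Nat.add_sub_cancel' huv.le])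

namespace IsConstantSystem

variable {S : ℕ → Prop} {ν : ℕ → ℕ → F}

/-- If the second constituent which is not short is long, then all constituents are short or
long. -/
theorem gap_short_or_long (h : IsConstantSystem S ν) {p t i : ℕ} [Fact p.Prime] [CharP F p]
    (hp2 : p ≠ 2) (hfirst : S (2 * p ^ t)) (hmin : ∀ j, 1 ≤ j → j < 2 * p ^ t → ¬ S j)
    (hlong : Gap S i (2 * p ^ t)) (hi : 2 * p ^ t ≤ i)
    (hshort : ∀ u m, 2 * p ^ t ≤ u → u < i → Gap S u m → m = p ^ t) {u m : ℕ}
    (hu : 2 * p ^ t ≤ u) (hgap : Gap S u m) : m = p ^ t ∨ m = 2 * p ^ t := by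
  have hp : p.Prime := Fact.out
  have hq : 0 < p ^ t := pow_pos hp.pos t
  have hn1 : 1 ≤ 2 * p ^ t := by omega
  have hex := fun {u : ℕ} (hu : 1 ≤ u) => h.exists_gap hn1 hfirst hmin hu
  induction u using Nat.strong_induction_on generalizing m with
  | _ u ih =>
  by_contra hbad
  push Not at hbad
  have hiu : i < u := by
    rcases lt_trichotomy u i with hlt | heq | hgt
    · exact absurd (hshort u m hu hlt hgap) hbad.1
    · exact absurd (hgap.unique (heq ▸ hlong)) hbad.2
    · exact hgt
  have hiu2 := hlong.le_of_lt hgap.start hiu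
  -- the constituents up to position `i`
  have hstart : ∀ l, (l + 2) * p ^ t ≤ i → S ((l + 2) * p ^ t) := by
    intro l hl
    induction l with
    | zero => simpa using hfirst
    | succ l ihl =>
      have hadd : (l + 1 + 2) * p ^ t = (l + 2) * p ^ t + p ^ t := by ring
      have hle : 2 * p ^ t ≤ (l + 2) * p ^ t := Nat.mul_le_mul_right _ (by omega)
      have hS := ihl (by omega)
      obtain ⟨m', -, hg⟩ := hex (by omega) hS
      obtain rfl := hshort _ _ hle (by omega) hg
      rw [hadd]; exact hg.last
  obtain ⟨r, hr⟩ : ∃ r, i = (r + 2) * p ^ t := by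
    have h2 : 2 ≤ i / p ^ t := (Nat.le_div_iff_mul_le hq).2 hi
    refine ⟨i / p ^ t - 2, ?_⟩
    rw [Nat.sub_add_cancel h2]
    have hle : i / p ^ t * p ^ t ≤ i := Nat.div_mul_le_self i _
    have hlt : i < i / p ^ t * p ^ t + p ^ t := by
      have := Nat.lt_div_mul_add (a := i) hq; exact this
    have hS := hstart (i / p ^ t - 2) (by rwa [Nat.sub_add_cancel h2])
    rw [Nat.sub_add_cancel h2] at hS
    have h2q : 2 * p ^ t ≤ i / p ^ t * p ^ t := Nat.mul_le_mul_right _ h2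
    by_contra hne
    obtain ⟨m', -, hg⟩ := hex (by omega) hS
    obtain rfl := hshort _ _ h2q (by omega) hg
    have := hg.le_of_lt hlong.start (by omega)
    omega
  -- the constituents up to position `u`
  have hreg : ∀ a, 2 ≤ a → a * p ^ t ≤ u →
      S (a * p ^ t) ∨ (2 * p ^ t ≤ (a - 1) * p ^ t ∧ Gap S ((a - 1) * p ^ t) (2 * p ^ t)) := by
    intro a ha2 hau
    induction a, ha2 using Nat.le_induction with
    | base => exact Or.inl hfirst
    | succ a ha2 iha =>
      have hadd : (a + 1) * p ^ t = a * p ^ t + p ^ t := by ring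
      have hle : 2 * p ^ t ≤ a * p ^ t := Nat.mul_le_mul_right _ ha2
      rcases iha (by omega) with hS | ⟨-, hg⟩
      · obtain ⟨m', -, hg⟩ := hex (by omega) hS
        rcases ih _ (by omega) hle hg with rfl | rfl
        · left; rw [hadd]; exact hg.last
        · right; exact ⟨hle, hg⟩
      · left
        have := hg.last
        rwa [← add_mul, show a - 1 + 2 = a + 1 by omega] at this
  obtain ⟨K, hK⟩ : ∃ K, u = K * p ^ t := by
    have h2 : 2 ≤ u / p ^ t := (Nat.le_div_iff_mul_le hq).2 hu
    refine ⟨u / p ^ t, ?_⟩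
    have hle : u / p ^ t * p ^ t ≤ u := Nat.div_mul_le_self u _
    have hlt : u < u / p ^ t * p ^ t + p ^ t := Nat.lt_div_mul_add (a := u) hq
    have h2q : 2 * p ^ t ≤ u / p ^ t * p ^ t := Nat.mul_le_mul_right _ h2
    by_contra hne
    rcases hreg _ h2 hle with hS | ⟨-, hg⟩
    · obtain ⟨m', -, hg⟩ := hex (by omega) hS
      have h3 := hg.le_of_lt hgap.start (by omega)
      rcases ih _ (by omega) h2q hg with rfl | rfl <;> omega
    · have hsub : (u / p ^ t - 1) * p ^ t + p ^ t = u / p ^ t * p ^ t := by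
        rw [← add_one_mul, Nat.sub_add_cancel (by omega)]
      have h3 := hg.le_of_lt hgap.start (by omega)
      omega
  -- the last long constituent before position `u`
  classical
  have hrK : r + 3 < K := by
    have : (r + 3) * p ^ t < K * p ^ t := by
      rw [← hK, show (r + 3) * p ^ t = (r + 2) * p ^ t + p ^ t by ring, ← hr]; omega
    exact lt_of_mul_lt_mul_right this (Nat.zero_le _)
  have hr3 : ¬ S ((r + 3) * p ^ t) := by
    have := hlong.inner (p ^ t) hq (by omega)
    rwa [hr, show (r + 2) * p ^ t + p ^ t = (r + 3) * p ^ t by ring] at this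
  -- A multiple of `q` beyond `2q` that is not in `S` is the middle of a long constituent; the
  -- largest one gives `g = (W - 1) q`.
  set W := Nat.findGreatest (fun a => ¬ S (a * p ^ t)) K with hW
  have hWr : r + 3 ≤ W := Nat.le_findGreatest (P := fun a => ¬ S (a * p ^ t)) hrK.le hr3
  have hWS : ¬ S (W * p ^ t) := Nat.findGreatest_spec (P := fun a => ¬ S (a * p ^ t)) hrK.le hr3
  have hWK : W ≤ K := Nat.findGreatest_le K
  have hWne : W ≠ K := by
    intro h0
    rw [h0, ← hK] at hWS
    exact hWS hgap.start
  have hWgt : ∀ a, W < a → a ≤ K → S (a * p ^ t) := fun a h1 h2 => by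
    simpa using Nat.findGreatest_is_greatest (P := fun a => ¬ S (a * p ^ t)) h1 h2
  have hWu : W * p ^ t ≤ u := by rw [hK]; exact Nat.mul_le_mul_right _ hWK
  obtain ⟨hg2, hg⟩ := (hreg W (by omega) hWu).resolve_left hWS
  obtain ⟨k, hk⟩ : ∃ k, K = W - 1 + (k + 2) := ⟨K - W - 1, by omega⟩
  have hku : u = (W - 1) * p ^ t + (k + 2) * p ^ t := by rw [hK, hk, add_mul]
  obtain ⟨hqm, hlen⟩ := h.gap_length hn1 hfirst hmin rfl (by omega) hgap
  obtain ⟨s, hst, hs⟩ := hlen.resolve_left hbad.2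
  have hstne : s ≠ t := by rintro rfl; exact hbad.1 (by omega)
  have hs0 : 0 < p ^ s := pow_pos hp.pos s
  -- Oddness of `p` leaves room here: `p ^ s + p ^ s' < q`, so a next length `2q - p ^ s'` other
  -- than `q` exceeds `q + p ^ s`.
  have hps : ∀ s' < t, 3 * p ^ s' ≤ p ^ t := by
    intro s' hs'
    have h3 : 3 ≤ p := by have := hp.two_le; omega
    calc 3 * p ^ s' ≤ p * p ^ s' := Nat.mul_le_mul_right _ h3
      _ = p ^ (s' + 1) := by ring
      _ ≤ p ^ t := Nat.pow_le_pow_right hp.pos hs'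
  have hss := hps s (by omega)
  have hP : Pattern S (p ^ t) r k m ((W - 1) * p ^ t) := by
    refine ⟨hq, by omega, by omega, by omega, fun l hl => hstart l ?_, fun l hl j hj1 hj => ?_, ?_,
      ?_, hg.start, hg.inner, fun a ha => ?_, fun a ha j hj1 hj => ?_, hku ▸ hgap⟩
    · rw [hr]; exact Nat.mul_le_mul_right _ (by omega)
    · have hli : (l + 2) * p ^ t ≤ i := by rw [hr]; exact Nat.mul_le_mul_right _ (by omega)
      rcases eq_or_lt_of_le hli with heq | hlt
      · rw [heq]; exact hlong.inner j hj1 (by omega)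
      · have h2q : 2 * p ^ t ≤ (l + 2) * p ^ t := Nat.mul_le_mul_right _ (by omega)
        obtain ⟨m', -, hg'⟩ := hex (by omega) (hstart l hli)
        obtain rfl := hshort _ _ h2q hlt hg'
        exact hg'.inner j hj1 hj
    · rw [← hr]; exact hlong.inner
    · rw [← hr]; exact hlong.last
    · rw [← add_mul]; exact hWgt _ (by omega) (by omega)
    · have hS : S ((W - 1) * p ^ t + (a + 2) * p ^ t) := by
        rw [← add_mul]; exact hWgt _ (by omega) (by omega)
      have hle : (a + 2) * p ^ t ≤ (k + 2) * p ^ t := Nat.mul_le_mul_right _ (by omega)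
      rcases eq_or_lt_of_le hle with heq | hlt
      · rw [heq, ← hku]; exact hgap.inner j hj1 (by omega)
      · obtain ⟨m', -, hg'⟩ := hex (by omega) hS
        refine hg'.inner j hj1 ?_
        rcases ih _ (by omega) (by omega) hg' with rfl | rfl <;> omega
  have hsodd : Odd (p ^ s) := (hp.odd_of_ne_two hp2).pow
  have hmodd : Odd m := by
    rcases hsodd with ⟨c, hc⟩
    exact Nat.odd_iff.2 (by omega)
  obtain ⟨m', -, hgap'⟩ := hex (by omega) hgap.last
  have hlen' := h.gap_length hn1 hfirst hmin rfl (by omega) hgap'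
  have hm' : m' = p ^ t ∨ p ^ t + p ^ s < m' := by
    rcases hlen'.2 with h1 | ⟨s', hs't, hs'⟩
    · right; omega
    · rcases eq_or_lt_of_le hs't with rfl | hlt
      · left; omega
      · right
        have := hps s' hlt
        omega
  have h1 := hP.k_le h hp2
  have h2 := hP.r_le h hp2 hmodd
  have h3 := hP.k_ne h hp2
  have h4 := hP.k_ne_of_next h hp2 hs (by rw [← hku]; exact hgap') hm'
  omega

/-- If the second two-step centralizer occurs only in weights which are multiples of `p`, then
so do most of the nonzero brackets. -/
theorem eq_zero_of_dvd_add (h : IsConstantSystem S ν) {p : ℕ} [Fact p.Prime] [CharP F p]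
    (hS : ∀ i, 1 ≤ i → S i → p ∣ i) {i j : ℕ} (hi : 1 ≤ i) (hj : 1 ≤ j) (hpi : ¬ p ∣ i)
    (hpij : p ∣ i + j) : ν i j = 0 := by
  have hp : p.Prime := Fact.out
  obtain ⟨k, rfl⟩ : ∃ k, j = 1 + k := ⟨j - 1, by omega⟩
  rw [h.apply_add hi le_rfl]
  refine Finset.sum_eq_zero fun l _ => ?_
  by_cases hl : S (i + l)
  · have hdvd := hS _ (by omega) hl
    have hl0 : l % p ≠ 0 := by
      intro h0
      exact hpi ((Nat.dvd_add_left (Nat.dvd_of_mod_eq_zero h0)).1 hdvd)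
    have hmod : (k + 1) % p = l % p := by
      have h1 : i + (k + 1) ≡ i + l [MOD p] := by
        rw [show i + (k + 1) = i + (1 + k) by ring]
        exact (Nat.modEq_zero_iff_dvd.2 hpij).trans (Nat.modEq_zero_iff_dvd.2 hdvd).symm
      exact Nat.ModEq.add_left_cancel' i h1
    have hkl : k % p < l % p := by
      have h1 := Nat.mod_lt k hp.pos
      rw [← hmod, Nat.add_mod, Nat.mod_eq_of_lt hp.one_lt]
      rcases eq_or_lt_of_le (show k % p + 1 ≤ p by omega) with h2 | h2
      · exfalso
        apply hl0
        rw [← hmod, Nat.add_mod, Nat.mod_eq_of_lt hp.one_lt, h2, Nat.mod_self]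
      · rw [Nat.mod_eq_of_lt h2]; omega
    have hz : (k.choose l : F) = 0 := by
      rw [CharP.cast_eq_zero_iff F p, ← Nat.modEq_zero_iff_dvd]
      have h1 := Choose.choose_modEq_choose_mod_mul_choose_div_nat (n := k) (k := l) (p := p)
      rwa [Nat.choose_eq_zero_of_lt hkl, zero_mul] at h1
    rw [hz]; ring
  · rw [h.one_of_not (by omega) hl, mul_zero]

end IsConstantSystem

end Constants

/-! ### Adapted bases -/

section Adapted

variable {F L : Type*} [Field F] [LieRing L] [LieAlgebra F L]

/-- Generators `x`, `y` and a basis `y = v₁, v₂, …` of an algebra of maximal class with two distinct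
two-step centralizers, spanned by `y` and `x`. -/
structure IsAdapted (𝒢 : ℕ → Submodule F L) (x y : L) (v : ℕ → L) (S : ℕ → Prop) : Prop where
  x_mem : x ∈ 𝒢 1
  one_eq : v 1 = y
  mem : ∀ {n}, 1 ≤ n → v n ∈ 𝒢 n
  ne_zero : ∀ {n}, 1 ≤ n → v n ≠ 0
  span_one : 𝒢 1 = Submodule.span F {x, y}
  span_eq : ∀ {n}, 2 ≤ n → 𝒢 n = Submodule.span F {v n}
  indep : ∀ {a b : F}, a • x + b • y = 0 → a = 0 ∧ b = 0
  S_iff : ∀ n, S n ↔ 2 ≤ n ∧ twoStep 𝒢 n ≠ twoStep 𝒢 2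
  lie_x_of : ∀ {n}, S n → ⁅v n, x⁆ = 0
  lie_y_of : ∀ {n}, S n → ⁅v n, y⁆ = v (n + 1)
  lie_x_of_not : ∀ {n}, 1 ≤ n → ¬ S n → ⁅v n, x⁆ = v (n + 1)
  lie_y_of_not : ∀ {n}, 1 ≤ n → ¬ S n → ⁅v n, y⁆ = 0

variable {𝒢 : ℕ → Submodule F L} [GradedLieAlgebra 𝒢]

theorem IsMaximalClass.finite_component (hL : IsMaximalClass 𝒢) (i : ℕ) : (𝒢 i).FG := by
  rw [← Module.Finite.iff_fg, ← Module.rank_lt_aleph0_iff]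
  rcases i with _ | _ | i
  · rw [hL.zero_eq_bot]; simpa using Cardinal.aleph0_pos
  · rw [zero_add, hL.rank_one]; exact Cardinal.natCast_lt_aleph0 (n := 2)
  · exact (hL.rank_le_one _ (by omega)).trans_lt Cardinal.one_lt_aleph0

theorem iSup_grading : ⨆ i, 𝒢 i = ⊤ :=
  (DirectSum.Decomposition.isInternal 𝒢).submodule_iSup_eq_top

/-- In an infinite-dimensional algebra of maximal class, no component of positive weight is
centralized by the component of weight one. -/
theorem IsMaximalClass.exists_lie_ne_zero (hL : IsMaximalClass 𝒢) (hinf : ¬ Module.Finite F L)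
    {i : ℕ} (hi : 1 ≤ i) : ∃ u ∈ 𝒢 1, ∃ w ∈ 𝒢 i, ⁅u, w⁆ ≠ 0 := by
  by_contra! hz
  apply hinf
  -- If the component of weight one kills `𝒢 i`, this truncation is stable under the generators,
  -- hence under all of `L`. It is then a subalgebra containing the generators, so `L` would be
  -- finite-dimensional.
  set A : Submodule F L := ⨆ j ∈ Finset.range (i + 1), 𝒢 j with hA
  have hfg : A.FG := Submodule.fg_biSup _ _ fun j _ => hL.finite_component j
  have hmem : ∀ j ≤ i, 𝒢 j ≤ A := fun j hj =>
    le_biSup (f := fun j => 𝒢 j) (Finset.mem_range.2 (by omega))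
  have hstab : ∀ u ∈ 𝒢 1, ∀ w ∈ A, ⁅u, w⁆ ∈ A := by
    intro u hu w hw
    rw [hA] at hw
    induction hw using Submodule.iSup_induction' with
    | zero => simp
    | add a b _ _ ha hb => rw [lie_add]; exact add_mem ha hb
    | mem j a ha =>
      by_cases hj : j ∈ Finset.range (i + 1)
      · rw [iSup_pos hj] at ha
        rw [Finset.mem_range] at hj
        rcases eq_or_lt_of_le (Nat.lt_succ_iff.1 hj) with rfl | hlt
        · rw [hz u hu a ha]; exact zero_mem _
        · exact hmem (1 + j) (by omega) (SetLike.GradedBracket.bracket_mem hu ha)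
      · rw [iSup_neg hj, Submodule.mem_bot] at ha
        rw [ha, lie_zero]; exact zero_mem _
  let N : LieSubalgebra F L :=
    { carrier := {u | ∀ w ∈ A, ⁅u, w⁆ ∈ A}
      add_mem' := fun ha hb w hw => by rw [add_lie]; exact add_mem (ha w hw) (hb w hw)
      zero_mem' := fun w _ => by rw [zero_lie]; exact zero_mem _
      smul_mem' := fun c a ha w hw => by rw [smul_lie]; exact A.smul_mem c (ha w hw)
      lie_mem' := fun {a b} ha hb w hw => by
        rw [lie_lie]; exact sub_mem (ha _ (hb w hw)) (hb _ (ha w hw)) }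
  have hN : N = ⊤ := by
    rw [eq_top_iff, ← hL.generated, LieSubalgebra.lieSpan_le]
    exact fun u hu w hw => hstab u hu w hw
  let B : LieSubalgebra F L :=
    { A with
      lie_mem' := fun {a b} _ hb => by
        have ha : a ∈ N := hN ▸ LieSubalgebra.mem_top a
        exact ha b hb }
  have hB : B = ⊤ := by
    rw [eq_top_iff, ← hL.generated, LieSubalgebra.lieSpan_le]
    exact hmem 1 hi
  have hAtop : A = ⊤ := by
    rw [eq_top_iff]
    intro u _
    have : u ∈ B := hB ▸ LieSubalgebra.mem_top u
    exact this
  exact Module.finite_def.2 (hAtop ▸ hfg)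

theorem IsMaximalClass.eq_span (hL : IsMaximalClass 𝒢) {n : ℕ} (hn : 2 ≤ n) {w : L}
    (hw : w ∈ 𝒢 n) (hw0 : w ≠ 0) : 𝒢 n = Submodule.span F {w} := by
  obtain ⟨w₀, -, h0⟩ := rank_submodule_le_one_iff (𝒢 n) |>.1 (hL.rank_le_one n hn)
  obtain ⟨c, rfl⟩ := Submodule.mem_span_singleton.1 (h0 hw)
  have hc : c ≠ 0 := by rintro rfl; exact hw0 (zero_smul _ _)
  refine le_antisymm ?_ ((Submodule.span_singleton_le_iff_mem _ _).2 hw)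
  rwa [Submodule.span_singleton_smul_eq (IsUnit.mk0 c hc)]

/-- The two-step centralizers of an infinite-dimensional algebra of maximal class have
dimension one. -/
theorem IsMaximalClass.exists_twoStep_eq_span (hL : IsMaximalClass 𝒢) (hinf : ¬ Module.Finite F L)
    {n : ℕ} (hn : 2 ≤ n) : ∃ c, c ≠ 0 ∧ twoStep 𝒢 n = Submodule.span F {c} := by
  obtain ⟨u, hu, w, hw, huw⟩ := hL.exists_lie_ne_zero hinf (i := n) (by omega)
  have hspan := hL.eq_span hn hw (by rintro rfl; exact huw (lie_zero u))
  have huw' : ⁅u, w⁆ ∈ 𝒢 (1 + n) := SetLike.GradedBracket.bracket_mem hu hw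
  have hspan' := hL.eq_span (n := 1 + n) (by omega) huw' huw
  let φ : 𝒢 1 →ₗ[F] L :=
    { toFun := fun a => ⁅(a : L), w⁆
      map_add' := fun a b => by simp
      map_smul' := fun c a => by simp }
  have hrange : LinearMap.range φ = Submodule.span F {⁅u, w⁆} := by
    refine le_antisymm ?_ ((Submodule.span_singleton_le_iff_mem _ _).2 ⟨⟨u, hu⟩, rfl⟩)
    rintro _ ⟨a, rfl⟩
    rw [← hspan']
    exact SetLike.GradedBracket.bracket_mem a.2 hw
  have hfin : Module.Finite F (𝒢 1) := Module.Finite.iff_fg.2 (hL.finite_component 1)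
  have h2 : Module.finrank F (𝒢 1) = 2 := by
    rw [Module.finrank, hL.rank_one]; simp
  have h1 := LinearMap.finrank_range_add_finrank_ker φ
  rw [hrange, finrank_span_singleton huw, h2] at h1
  obtain ⟨c, hc0, hc⟩ := finrank_eq_one_iff'.1
    (show Module.finrank F (LinearMap.ker φ) = 1 by omega)
  refine ⟨((c : 𝒢 1) : L), by simpa using hc0, le_antisymm ?_ ?_⟩
  · rintro a ⟨ha, haw⟩
    obtain ⟨d, hd⟩ := hc ⟨⟨a, ha⟩, haw w hw⟩
    refine Submodule.mem_span_singleton.2 ⟨d, ?_⟩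
    simpa using congrArg (fun z : LinearMap.ker φ => ((z : 𝒢 1) : L)) hd
  · rw [Submodule.span_singleton_le_iff_mem]
    refine ⟨(c : 𝒢 1).2, fun b hb => ?_⟩
    rw [hspan] at hb
    obtain ⟨d, rfl⟩ := Submodule.mem_span_singleton.1 hb
    have hcw : ⁅((c : 𝒢 1) : L), w⁆ = 0 := c.2
    rw [lie_smul, hcw, smul_zero]

theorem span_singleton_eq_of_mem {a b : L} (ha : a ≠ 0) (h : a ∈ Submodule.span F {b}) :
    Submodule.span F {a} = Submodule.span F {b} := by
  obtain ⟨c, rfl⟩ := Submodule.mem_span_singleton.1 h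
  have hc : c ≠ 0 := by rintro rfl; exact ha (zero_smul _ _)
  exact Submodule.span_singleton_smul_eq (IsUnit.mk0 c hc) b

theorem IsMaximalClass.exists_isAdapted (hL : IsMaximalClass 𝒢) (hinf : ¬ Module.Finite F L)
    (htwo : (twoStepSet 𝒢).ncard = 2) :
    ∃ (x y : L) (v : ℕ → L) (S : ℕ → Prop), IsAdapted 𝒢 x y v S := by
  obtain ⟨A, B, hAB, hset⟩ := Set.ncard_eq_two.1 htwo
  obtain ⟨C, hC, hC2⟩ : ∃ C, C ≠ twoStep 𝒢 2 ∧ twoStepSet 𝒢 = {twoStep 𝒢 2, C} := by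
    have h2 : twoStep 𝒢 2 ∈ twoStepSet 𝒢 := ⟨2, by simp, rfl⟩
    rw [hset] at h2
    rcases h2 with h2 | h2
    · exact ⟨B, by rw [h2]; exact hAB.symm, by rw [h2, hset]⟩
    · rw [Set.mem_singleton_iff] at h2
      exact ⟨A, by rw [h2]; exact hAB, by rw [h2, hset, Set.pair_comm]⟩
  obtain ⟨n, hn, hnC⟩ : C ∈ twoStepSet 𝒢 := by rw [hC2]; simp
  have hor : ∀ i, 2 ≤ i → twoStep 𝒢 i = twoStep 𝒢 2 ∨ twoStep 𝒢 i = C := by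
    intro i hi
    have : twoStep 𝒢 i ∈ twoStepSet 𝒢 := ⟨i, hi, rfl⟩
    rw [hC2] at this
    simpa using this
  obtain ⟨y, hy0, hy⟩ := hL.exists_twoStep_eq_span hinf (n := 2) le_rfl
  obtain ⟨x, hx0, hx⟩ := hL.exists_twoStep_eq_span hinf (n := n) hn
  rw [hnC] at hx
  have hx1 : x ∈ 𝒢 1 := by
    have : x ∈ twoStep 𝒢 n := by rw [hnC, hx]; exact Submodule.mem_span_singleton_self x
    exact this.1
  have hy1 : y ∈ 𝒢 1 := by
    have : y ∈ twoStep 𝒢 2 := by rw [hy]; exact Submodule.mem_span_singleton_self y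
    exact this.1
  have hindep : ∀ {a b : F}, a • x + b • y = 0 → a = 0 ∧ b = 0 := by
    intro a b hab
    have ha : a = 0 := by
      by_contra ha
      apply hC
      rw [hx, hy]
      refine span_singleton_eq_of_mem hx0 (Submodule.mem_span_singleton.2 ⟨-(a⁻¹ * b), ?_⟩)
      have : a • x = -(b • y) := eq_neg_of_add_eq_zero_left hab
      rw [neg_smul, mul_smul, ← smul_neg, ← this, smul_smul, inv_mul_cancel₀ ha, one_smul]
    refine ⟨ha, ?_⟩
    rw [ha, zero_smul, zero_add] at hab
    exact (smul_eq_zero.1 hab).resolve_right hy0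
  have hli : LinearIndependent F ![x, y] := LinearIndependent.pair_iff.2 fun a b => hindep
  have hspan1 : 𝒢 1 = Submodule.span F {x, y} := by
    have hfin : Module.Finite F (𝒢 1) := Module.Finite.iff_fg.2 (hL.finite_component 1)
    refine (Submodule.eq_of_le_of_finrank_eq ?_ ?_).symm
    · rw [Submodule.span_le]
      rintro a (rfl | rfl)
      · exact hx1
      · exact hy1
    · have h1 := finrank_span_eq_card hli
      rw [Matrix.range_cons, Matrix.range_cons, Matrix.range_empty, Set.union_empty,
        Set.singleton_union] at h1
      rw [h1, Module.finrank, hL.rank_one]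
      simp
  -- Only two centralizers occur, so `x + y` avoids all of them, and iterated bracketing with it
  -- never gives zero.
  have hxy : ∀ i, 2 ≤ i → x + y ∉ twoStep 𝒢 i := by
    intro i hi hmem
    rcases hor i hi with h1 | h1 <;> rw [h1] at hmem
    · rw [hy] at hmem
      obtain ⟨c, hc⟩ := Submodule.mem_span_singleton.1 hmem
      have := hindep (a := 1) (b := 1 - c) (by rw [sub_smul, hc]; module)
      exact one_ne_zero this.1
    · rw [hx] at hmem
      obtain ⟨c, hc⟩ := Submodule.mem_span_singleton.1 hmem
      have := hindep (a := 1 - c) (b := 1) (by rw [sub_smul, hc]; module)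
      exact one_ne_zero this.2
  let v : ℕ → L := fun n => (fun w => ⁅w, x + y⁆)^[n - 1] y
  have hv1 : v 1 = y := rfl
  have hvs : ∀ n, 1 ≤ n → v (n + 1) = ⁅v n, x + y⁆ := by
    intro n hn
    obtain ⟨k, rfl⟩ : ∃ k, n = k + 1 := ⟨n - 1, by omega⟩
    simp only [v, Nat.add_sub_cancel, Function.iterate_succ_apply']
  have hvmem : ∀ {n}, 1 ≤ n → v n ∈ 𝒢 n := by
    intro n hn
    induction n, hn using Nat.le_induction with
    | base => exact hy1
    | succ n hn ih => rw [hvs n hn]; exact SetLike.GradedBracket.bracket_mem ih (add_mem hx1 hy1)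
  have hv0 : ∀ {n}, 1 ≤ n → v n ≠ 0 := by
    intro n hn
    induction n, hn using Nat.le_induction with
    | base => exact hy0
    | succ n hn ih =>
      rw [hvs n hn]
      intro h0
      rcases eq_or_lt_of_le hn with rfl | hlt
      · obtain ⟨a, ha, b, hb, hab⟩ := hL.exists_lie_ne_zero hinf (i := 1) le_rfl
        rw [hspan1, Submodule.mem_span_pair] at ha hb
        obtain ⟨a1, a2, rfl⟩ := ha
        obtain ⟨b1, b2, rfl⟩ := hb
        rw [hv1, lie_add, lie_self, add_zero] at h0
        have h0' : ⁅x, y⁆ = 0 := by rw [← lie_skew, h0, neg_zero]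
        apply hab
        simp [h0, h0']
      · apply hxy n (by omega)
        refine ⟨add_mem hx1 hy1, fun w hw => ?_⟩
        rw [hL.eq_span (by omega) (hvmem hn) ih] at hw
        obtain ⟨c, rfl⟩ := Submodule.mem_span_singleton.1 hw
        rw [lie_smul, ← lie_skew, h0, neg_zero, smul_zero]
  let S : ℕ → Prop := fun n => 2 ≤ n ∧ twoStep 𝒢 n ≠ twoStep 𝒢 2
  have hlx : ∀ {n}, S n → ⁅v n, x⁆ = 0 := by
    rintro n ⟨hn, hne⟩
    have hxm : x ∈ twoStep 𝒢 n := by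
      rw [(hor n hn).resolve_left hne, hx]; exact Submodule.mem_span_singleton_self x
    rw [← lie_skew, hxm.2 _ (hvmem (by omega)), neg_zero]
  have hly : ∀ {n}, 1 ≤ n → ¬ S n → ⁅v n, y⁆ = 0 := by
    intro n hn hS
    rcases eq_or_lt_of_le hn with rfl | hlt
    · rw [hv1, lie_self]
    · have heq : twoStep 𝒢 n = twoStep 𝒢 2 := by
        by_contra hne; exact hS ⟨hlt, hne⟩
      have hym : y ∈ twoStep 𝒢 n := by rw [heq, hy]; exact Submodule.mem_span_singleton_self y
      rw [← lie_skew, hym.2 _ (hvmem (by omega)), neg_zero]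
  refine ⟨x, y, v, S, hx1, hv1, hvmem, hv0, hspan1,
    fun hn => hL.eq_span hn (hvmem (by omega)) (hv0 (by omega)), hindep, fun n => Iff.rfl, hlx,
    fun {n} hS => ?_, fun {n} hn hS => ?_, hly⟩
  · rw [hvs n (by have := hS.1; omega), lie_add, hlx hS, zero_add]
  · rw [hvs n hn, lie_add, hly hn hS, add_zero]

namespace IsAdapted

variable {x y : L} {v : ℕ → L} {S : ℕ → Prop}

theorem exists_constants (h : IsAdapted 𝒢 x y v S) :
    ∃ ν : ℕ → ℕ → F, ∀ i j, 1 ≤ i → 1 ≤ j → ⁅v i, v j⁆ = ν i j • v (i + j) := by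
  have h1 : ∀ i j, ∃ c : F, 1 ≤ i → 1 ≤ j → ⁅v i, v j⁆ = c • v (i + j) := by
    intro i j
    by_cases hij : 1 ≤ i ∧ 1 ≤ j
    · have h1 : ⁅v i, v j⁆ ∈ 𝒢 (i + j) :=
        SetLike.GradedBracket.bracket_mem (h.mem hij.1) (h.mem hij.2)
      rw [h.span_eq (by omega)] at h1
      obtain ⟨c, hc⟩ := Submodule.mem_span_singleton.1 h1
      exact ⟨c, fun _ _ => hc.symm⟩
    · exact ⟨0, fun h1 h2 => absurd ⟨h1, h2⟩ hij⟩
  choose ν hν using h1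
  exact ⟨ν, hν⟩

omit [GradedLieAlgebra 𝒢] in
-- Everything is the identity `[v_i, [v_j, z]] = [[v_i, v_j], z] - [[v_i, z], v_j]`, with `z = x +
-- y` for the recursion, and with `z = y` or `z = x`, whichever commutes with `v_j`, for the other
-- relations.
theorem isConstantSystem (h : IsAdapted 𝒢 x y v S) {ν : ℕ → ℕ → F}
    (hν : ∀ i j, 1 ≤ i → 1 ≤ j → ⁅v i, v j⁆ = ν i j • v (i + j)) : IsConstantSystem S ν := by
  have hcancel : ∀ {n : ℕ} {a b : F}, 1 ≤ n → a • v n = b • v n → a = b :=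
    fun hn hab => smul_left_injective F (h.ne_zero hn) hab
  have jac : ∀ (a b z : L), ⁅a, ⁅b, z⁆⁆ = ⁅⁅a, b⁆, z⁆ - ⁅⁅a, z⁆, b⁆ := by
    intro a b z
    rw [leibniz_lie a b z, ← lie_skew b ⁅a, z⁆]; abel
  have hz : ∀ {n}, 1 ≤ n → ⁅v n, x + y⁆ = v (n + 1) := by
    intro n hn
    by_cases hS : S n
    · rw [lie_add, h.lie_x_of hS, h.lie_y_of hS, zero_add]
    · rw [lie_add, h.lie_x_of_not hn hS, h.lie_y_of_not hn hS, add_zero]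
  have hr : ∀ i j, i + 1 + j = i + j + 1 := fun i j => by ring
  have hsucc : ∀ {i j}, 1 ≤ i → 1 ≤ j → ν i (j + 1) = ν i j - ν (i + 1) j := by
    intro i j hi hj
    refine hcancel (n := i + j + 1) (by omega) ?_
    rw [sub_smul, show i + j + 1 = i + (j + 1) by ring, ← hν _ _ hi (by omega), ← hz hj, jac,
      hν _ _ hi hj, smul_lie, hz (by omega), hz hi, hν _ _ (by omega) hj, hr, add_assoc]
  refine ⟨fun {i j} hi hj => ?_, fun hS => ?_, fun {i} hi hS => ?_,
    fun {i} hi hS => ?_, hsucc, fun {i j} hi hj hSi hSj hS => ?_, fun {i j} hi hj hSi hSj hS => ?_,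
    fun {i j} hi hj hSi hSj hS => ?_, fun {i j} hi hj hSi hSj hS => ?_,
    fun {i j} hi hj hSi hSj hS => ?_, fun {i j} hi hj hSi hSj hS => ?_⟩
  · refine hcancel (n := i + j) (by omega) ?_
    rw [neg_smul, ← hν i j hi hj, add_comm, ← hν j i hj hi, lie_skew]
  · exact ((h.S_iff 2).1 hS).2 rfl
  · refine hcancel (n := i + 1) (by omega) ?_
    rw [← hν i 1 hi le_rfl, h.one_eq, h.lie_y_of hS, one_smul]
  · refine hcancel (n := i + 1) (by omega) ?_
    rw [← hν i 1 hi le_rfl, h.one_eq, h.lie_y_of_not hi hS, zero_smul]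
  · have h1 := jac (v i) (v j) y
    rw [h.lie_y_of_not hj hSj, lie_zero, hν _ _ hi hj, smul_lie, h.lie_y_of hS,
      h.lie_y_of_not hi hSi, zero_lie, sub_zero] at h1
    exact (smul_eq_zero.1 h1.symm).resolve_right (h.ne_zero (by omega))
  · have h1 := jac (v i) (v j) y
    rw [h.lie_y_of_not hj hSj, lie_zero, hν _ _ hi hj, smul_lie, h.lie_y_of_not (by omega) hS,
      h.lie_y_of hSi, smul_zero, zero_sub, hν _ _ (by omega) hj, zero_eq_neg] at h1
    exact (smul_eq_zero.1 h1).resolve_right (h.ne_zero (by omega))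
  · have h1 := jac (v i) (v j) y
    rw [h.lie_y_of_not hj hSj, lie_zero, hν _ _ hi hj, smul_lie, h.lie_y_of hS,
      h.lie_y_of hSi, hν _ _ (by omega) hj, hr, eq_comm, sub_eq_zero] at h1
    exact hcancel (by omega) h1
  · have h1 := jac (v i) (v j) x
    rw [h.lie_x_of hSj, lie_zero, hν _ _ hi hj, smul_lie, h.lie_x_of_not (by omega) hS,
      h.lie_x_of hSi, zero_lie, sub_zero] at h1
    exact (smul_eq_zero.1 h1.symm).resolve_right (h.ne_zero (by omega))
  · have h1 := jac (v i) (v j) x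
    rw [h.lie_x_of hSj, lie_zero, hν _ _ hi hj, smul_lie, h.lie_x_of hS,
      h.lie_x_of_not hi hSi, smul_zero, zero_sub, hν _ _ (by omega) hj, zero_eq_neg] at h1
    exact (smul_eq_zero.1 h1).resolve_right (h.ne_zero (by omega))
  · have h1 := jac (v i) (v j) x
    rw [h.lie_x_of hSj, lie_zero, hν _ _ hi hj, smul_lie, h.lie_x_of_not (by omega) hS,
      h.lie_x_of_not hi hSi, hν _ _ (by omega) hj, hr, eq_comm, sub_eq_zero] at h1
    exact (hcancel (by omega) h1).symm

/-! ### Constituents -/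

omit [GradedLieAlgebra 𝒢] in
theorem isConstituent_iff (h : IsAdapted 𝒢 x y v S) {i m : ℕ} (hi : 1 ≤ i) :
    IsConstituent 𝒢 i m ↔ Gap S i m := by
  constructor
  · rintro (_ | ⟨_, _, h2, hm, hprev, hlast, hinner⟩)
    · omega
    · exact ⟨(h.S_iff i).2 ⟨h2, hprev⟩, hm, (h.S_iff _).2 ⟨by omega, hlast⟩,
        fun j hj1 hj hS => ((h.S_iff _).1 hS).2 (hinner _ (by omega) (by omega))⟩
  · intro hg
    obtain ⟨h2, hprev⟩ := (h.S_iff i).1 hg.start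
    refine .later i m h2 hg.pos hprev ((h.S_iff _).1 hg.last).2 fun j hj1 hj => ?_
    by_contra hne
    refine hg.inner (j - i) (by omega) (by omega) ?_
    rw [Nat.add_sub_cancel' hj1.le]
    exact (h.S_iff j).2 ⟨by omega, hne⟩

omit [GradedLieAlgebra 𝒢] in
theorem isConstituent_zero_iff (h : IsAdapted 𝒢 x y v S) {m n : ℕ} (hn : S n)
    (hmin : ∀ j, 1 ≤ j → j < n → ¬ S j) : IsConstituent 𝒢 0 m ↔ m = n := by
  have hn2 := (h.S_iff n).1 hn
  constructor
  · rintro (⟨_, h2, hlast, hinner⟩ | ⟨_, _, h2, _⟩)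
    · rcases lt_trichotomy m n with hlt | heq | hgt
      · exact absurd ((h.S_iff m).2 ⟨h2, hlast⟩) (hmin m (by omega) hlt)
      · exact heq
      · exact absurd (hinner n hn2.1 hgt) hn2.2
    · omega
  · rintro rfl
    refine .first m hn2.1 hn2.2 fun j hj2 hj => ?_
    by_contra hne
    exact hmin j (by omega) hj ((h.S_iff j).2 ⟨hj2, hne⟩)

omit [GradedLieAlgebra 𝒢] in
theorem firstLength_eq (h : IsAdapted 𝒢 x y v S) {n : ℕ} (hn : S n)
    (hmin : ∀ j, 1 ≤ j → j < n → ¬ S j) : firstLength 𝒢 = n := by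
  have hn2 := (h.S_iff n).1 hn
  refine le_antisymm (Nat.sInf_le hn2) (le_csInf ⟨n, hn2⟩ fun j hj => ?_)
  by_contra hlt
  exact hmin j (by have := hj.1; omega) (by omega) ((h.S_iff j).2 hj)

end IsAdapted

end Adapted

/-! ### The structure constants of an inflated algebra -/

section InflationConstants

variable {F : Type*} [Field F] {S : ℕ → Prop} {ν : ℕ → ℕ → F}

namespace IsConstantSystem

variable {p : ℕ} [Fact p.Prime] [CharP F p]

/-- Here `i` and `i'` are the distances to the next multiples of `p`. The case `i + i' = p` is
`eq_zero_of_dvd_add`; the recursion for `ν` lowers `i + i'` by one. -/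
theorem eq_zero_of_le (h : IsConstantSystem S ν) (hS : ∀ i, 1 ≤ i → S i → p ∣ i)
    {n m i i' : ℕ} (hn : 1 ≤ n) (hm : 1 ≤ m) (hi : i < p) (hi' : i' < p) (hni : p ∣ n + i)
    (hmi : p ∣ m + i') (hle : p ≤ i + i') : ν n m = 0 := by
  obtain ⟨d, hd⟩ : ∃ d, i + i' = p + d := ⟨i + i' - p, by omega⟩
  induction d generalizing n m i i' with
  | zero =>
    refine h.eq_zero_of_dvd_add hS hn hm ?_ ?_
    · intro hpn
      exact Nat.not_dvd_of_pos_of_lt (by omega) hi ((Nat.dvd_add_right hpn).1 hni)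
    · have h1 := dvd_add hni hmi
      rw [show n + i + (m + i') = n + m + p by omega] at h1
      exact (Nat.dvd_add_left dvd_rfl).1 h1
  | succ d ih =>
    have h1 := h.succ hn hm
    rw [ih (n := n) (m := m + 1) (i := i) (i' := i' - 1) hn (by omega) hi (by omega) hni
        (by convert hmi using 1; omega) (by omega) (by omega),
      ih (n := n + 1) (m := m) (i := i - 1) (i' := i') (by omega) hm (by omega) hi'
        (by convert hni using 1; omega) hmi (by omega) (by omega)] at h1
    linear_combination -h1

/-- The recursion for `ν` is Pascal's rule in `i` and `i'`. -/
theorem eq_choose_mul (h : IsConstantSystem S ν) (hS : ∀ i, 1 ≤ i → S i → p ∣ i)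
    {n m i i' : ℕ} (hn : 1 ≤ n) (hm : 1 ≤ m) (hlt : i + i' < p) (hni : p ∣ n + i)
    (hmi : p ∣ m + i') : ν n m = ((i + i').choose i : F) * ν (n + i) (m + i') := by
  obtain ⟨d, hd⟩ : ∃ d, i + i' = d := ⟨_, rfl⟩
  have hp1 : 1 < p := (Fact.out : p.Prime).one_lt
  induction d generalizing n m i i' with
  | zero =>
    obtain ⟨rfl, rfl⟩ : i = 0 ∧ i' = 0 := by omega
    simp
  | succ d ih =>
    have h1 := h.succ hn hm
    rcases Nat.eq_zero_or_pos i with rfl | hi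
    · rw [h.eq_zero_of_le hS (n := n + 1) (m := m) (i := p - 1) (i' := i') (by omega) hm (by omega)
        (by omega) (by rw [show n + 1 + (p - 1) = n + 0 + p by omega]; exact dvd_add hni dvd_rfl)
        hmi (by omega),
        ih (n := n) (m := m + 1) (i := 0) (i' := i' - 1) hn (by omega) (by omega) hni
          (by convert hmi using 1; omega) (by omega)] at h1
      rw [show m + 1 + (i' - 1) = m + i' by omega] at h1
      simp at h1 ⊢
      exact h1.symm
    rcases Nat.eq_zero_or_pos i' with rfl | hi'
    · have h2 := h.succ hm hn
      rw [h.eq_zero_of_le hS (n := m + 1) (m := n) (i := p - 1) (i' := i) (by omega) hn (by omega)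
        (by omega) (by rw [show m + 1 + (p - 1) = m + 0 + p by omega]; exact dvd_add hmi dvd_rfl)
        hni (by omega), sub_zero, h.skew hm (by omega), h.skew hm hn,
        ih (n := n + 1) (m := m) (i := i - 1) (i' := 0) (by omega) hm (by omega)
          (by convert hni using 1; omega) hmi (by omega)] at h2
      rw [show n + 1 + (i - 1) = n + i by omega] at h2
      simp at h2 ⊢
      exact h2.symm
    obtain ⟨a, rfl⟩ : ∃ a, i = a + 1 := ⟨i - 1, by omega⟩
    obtain ⟨b, rfl⟩ : ∃ b, i' = b + 1 := ⟨i' - 1, by omega⟩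
    rw [ih (n := n) (m := m + 1) (i := a + 1) (i' := b) hn (by omega) (by omega) hni
        (by convert hmi using 1; omega) (by omega),
      ih (n := n + 1) (m := m) (i := a) (i' := b + 1) (by omega) hm (by omega)
        (by convert hni using 1; omega) hmi (by omega)] at h1
    rw [show m + 1 + b = m + (b + 1) by ring, show n + 1 + a = n + (a + 1) by ring] at h1
    rw [show a + 1 + (b + 1) = (a + b + 1) + 1 by ring, Nat.choose_succ_succ]
    rw [show a + 1 + b = a + b + 1 by ring, show a + (b + 1) = a + b + 1 by ring] at h1
    push_cast
    linear_combination -h1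

end IsConstantSystem

end InflationConstants

/-! ### Powers of `ε` in the truncated polynomial algebra -/

section InflationFormulas

variable {F : Type*} [Field F] {p : ℕ}

theorem eps_pow_self : eps F p ^ p = 0 := by
  have h := AdjoinRoot.mk_self (f := (Polynomial.X ^ p : F[X]))
  rwa [map_pow, AdjoinRoot.mk_X] at h

theorem eps_pow_of_le {n : ℕ} (h : p ≤ n) : eps F p ^ n = 0 :=
  pow_eq_zero_of_le h eps_pow_self

theorem truncDer_eps [CharP F p] : truncDer F p (eps F p) = 1 := by
  have h := Derivation.liftOfSurjective_apply (R := F)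
    (f := AdjoinRoot.mkₐ (Polynomial.X ^ p : F[X]))
    (d := Polynomial.derivative') AdjoinRoot.mk_surjective (by
      intro f hf
      obtain ⟨g, rfl⟩ := AdjoinRoot.mk_eq_zero.1 hf
      refine AdjoinRoot.mk_eq_zero.2 ⟨Polynomial.derivative g, ?_⟩
      simp) Polynomial.X
  refine Eq.trans ?_ (h.trans ?_)
  · rfl
  · simp

theorem truncDer_eps_pow [CharP F p] (i : ℕ) :
    truncDer F p (eps F p ^ i) = (i : F) • eps F p ^ (i - 1) := by
  rw [Derivation.leibniz_pow, truncDer_eps, smul_eq_mul, mul_one, Nat.cast_smul_eq_nsmul]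

/-- The powers of `ε` form a basis of `F[ε]/(ε^p)`. -/
def truncBasis (F : Type*) [Field F] (p : ℕ) : Module.Basis (Fin p) F (Trunc F p) :=
  (AdjoinRoot.powerBasis' (Polynomial.monic_X_pow (R := F) p)).basis.reindex
    (finCongr (by simp))

theorem truncBasis_apply (i : Fin p) : truncBasis F p i = eps F p ^ (i : ℕ) := by
  rw [truncBasis, Module.Basis.reindex_apply, PowerBasis.basis_eq_pow]
  rfl

variable {N : Type*} [LieRing N] [LieAlgebra F N]

theorem inflationDer_tmul [CharP F p] (I : LieIdeal F N) (s : N) (a : Trunc F p) (u : I) :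
    inflationDer p I s (a ⊗ₜ[F] u) =
      truncDer F p a ⊗ₜ[F] u + (eps F p ^ (p - 1) * a) ⊗ₜ[F] idealDer I s u := by
  rfl

end InflationFormulas

section LieMap

variable {F L L' : Type*} [Field F] [LieRing L] [LieAlgebra F L] [LieRing L'] [LieAlgebra F L']

theorem map_lie_of_span_eq_top {A : Set L} (hA : Submodule.span F A = ⊤) (f : L →ₗ[F] L')
    (h : ∀ a ∈ A, ∀ b ∈ A, f ⁅a, b⁆ = ⁅f a, f b⁆) (a b : L) : f ⁅a, b⁆ = ⁅f a, f b⁆ := by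
  have ha : a ∈ Submodule.span F A := hA ▸ Submodule.mem_top
  have hb : b ∈ Submodule.span F A := hA ▸ Submodule.mem_top
  induction ha, hb using Submodule.span_induction₂ with
  | mem_mem a b ha hb => exact h a ha b hb
  | zero_left b _ => simp
  | zero_right a _ => simp
  | add_left a a' b _ _ _ h1 h2 => simp [h1, h2]
  | add_right a b b' _ _ _ h1 h2 => simp [h1, h2]
  | smul_left c a b _ _ h1 => simp [h1]
  | smul_right c a b _ _ h1 => simp [h1]

end LieMap

/-! ### A basis of the whole algebra -/

section AdaptedBasis

variable {F L : Type*} [Field F] [LieRing L] [LieAlgebra F L]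
variable {𝒢 : ℕ → Submodule F L} [GradedLieAlgebra 𝒢]

namespace IsAdapted

variable {x y : L} {v : ℕ → L} {S : ℕ → Prop}

theorem linearIndependent_succ (h : IsAdapted 𝒢 x y v S) {f : ℕ → ℕ} (hf : Function.Injective f)
    (hf1 : ∀ k, 1 ≤ f k) : LinearIndependent F fun k => v (f k) := by
  have h1 : iSupIndep fun k => 𝒢 (f k) :=
    (DirectSum.Decomposition.isInternal 𝒢).submodule_iSupIndep.comp hf
  exact h1.linearIndependent _ (fun k => h.mem (hf1 k)) fun k => h.ne_zero (hf1 k)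

theorem linearIndependent_option (h : IsAdapted 𝒢 x y v S) :
    LinearIndependent F fun o : Option ℕ => o.elim x fun k => v (k + 1) := by
  rw [_root_.linearIndependent_option]
  refine ⟨h.linearIndependent_succ (fun _ _ h => Nat.succ_injective h) (fun k => by omega), ?_⟩
  intro hx
  -- Projection to weight one sends the span of all `v_n` into the line of `y`, which does not
  -- contain `x`.
  let P : L →ₗ[F] L := (𝒢 1).subtype ∘ₗ DirectSum.component F ℕ (fun i => 𝒢 i) 1 ∘ₗ
    (DirectSum.decomposeLinearEquiv 𝒢).toLinearMap
  have hP1 : ∀ w ∈ 𝒢 1, P w = w := fun w hw => DirectSum.decompose_of_mem_same 𝒢 hw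
  have hle : Submodule.span F (Set.range ((fun o : Option ℕ => o.elim x fun k => v (k + 1)) ∘ some))
      ≤ (Submodule.span F {y}).comap P := by
    rw [Submodule.span_le]
    rintro _ ⟨k, rfl⟩
    change P (v (k + 1)) ∈ Submodule.span F {y}
    rcases Nat.eq_zero_or_pos k with rfl | hk
    · rw [hP1 _ (h.mem le_rfl)]
      rw [h.one_eq]
      exact Submodule.mem_span_singleton_self y
    · have : P (v (k + 1)) = 0 :=
        DirectSum.decompose_of_mem_ne 𝒢 (h.mem (n := k + 1) (by omega)) (by omega)
      rw [this]; exact zero_mem _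
  have h1 : P x ∈ Submodule.span F {y} := hle hx
  rw [hP1 x h.x_mem] at h1
  obtain ⟨c, hc⟩ := Submodule.mem_span_singleton.1 h1
  exact one_ne_zero (h.indep (a := 1) (b := -c) (by rw [neg_smul, hc]; module)).1

theorem span_eq_top (h : IsAdapted 𝒢 x y v S) (h0 : 𝒢 0 = ⊥) :
    Submodule.span F (Set.range fun o : Option ℕ => o.elim x fun k => v (k + 1)) = ⊤ := by
  rw [eq_top_iff, ← iSup_grading (𝒢 := 𝒢), iSup_le_iff]
  have hv : ∀ n, 1 ≤ n →
      v n ∈ Submodule.span F (Set.range fun o : Option ℕ => o.elim x fun k => v (k + 1)) := by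
    intro n hn
    refine Submodule.subset_span ⟨some (n - 1), ?_⟩
    simp [Nat.sub_add_cancel hn]
  intro n
  rcases n with _ | _ | n
  · rw [h0]; exact bot_le
  · rw [zero_add, h.span_one, Submodule.span_le]
    rintro a (rfl | rfl)
    · exact Submodule.subset_span ⟨none, rfl⟩
    · rw [← h.one_eq]; exact hv 1 le_rfl
  · rw [h.span_eq (by omega), Submodule.span_singleton_le_iff_mem]
    exact hv _ (by omega)

/-- The basis `x, v₁, v₂, …` -/
def basis (h : IsAdapted 𝒢 x y v S) (h0 : 𝒢 0 = ⊥) : Module.Basis (Option ℕ) F L :=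
  Module.Basis.mk h.linearIndependent_option (h.span_eq_top h0).ge

theorem basis_none (h : IsAdapted 𝒢 x y v S) (h0 : 𝒢 0 = ⊥) : h.basis h0 none = x := by
  simp [basis]

theorem basis_some (h : IsAdapted 𝒢 x y v S) (h0 : 𝒢 0 = ⊥) (k : ℕ) :
    h.basis h0 (some k) = v (k + 1) := by
  simp [basis]

end IsAdapted

end AdaptedBasis

/-! ### The isomorphism with the inflation -/

section InflationEquiv

theorem cast_factorial_ne_zero {F : Type*} [Field F] {p : ℕ} [Fact p.Prime] [CharP F p] {i : ℕ}
    (hi : i < p) : (i.factorial : F) ≠ 0 := by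
  rw [Ne, CharP.cast_eq_zero_iff F p, (Fact.out : p.Prime).dvd_factorial]
  omega

theorem cast_factorial_pred {F : Type*} [Field F] {p : ℕ} [Fact p.Prime] [CharP F p] :
    ((p - 1).factorial : F) = -1 := by
  have h := congrArg (ZMod.castHom (dvd_refl p) F) (ZMod.wilsons_lemma p)
  rwa [map_natCast, map_neg, map_one] at h

variable {F N : Type*} [Field F] [LieRing N] [LieAlgebra F N]
variable (p : ℕ) [Fact p.Prime] [CharP F p]

/-- Pairs `(i, j)` with `i < p` number the positive weights `p (j + 1) - i`. -/
def weightEquiv : ℕ ≃ Fin p × ℕ :=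
  haveI : NeZero p := ⟨(Fact.out : p.Prime).ne_zero⟩
  (Nat.divModEquiv p).trans ((Equiv.prodComm ℕ (Fin p)).trans
    (Equiv.prodCongr Fin.revPerm (Equiv.refl ℕ)))

omit [CharP F p] in
theorem weightEquiv_apply {k i j : ℕ} (hi : i < p) (hk : k + 1 + i = p * (j + 1)) :
    weightEquiv p k = (⟨i, hi⟩, j) := by
  have hkj : k = (p - 1 - i) + p * j := by rw [mul_add, mul_one] at hk; omega
  have hdiv : k / p = j := by
    rw [hkj, Nat.add_mul_div_left _ _ (by omega), Nat.div_eq_of_lt (by omega), zero_add]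
  have hmod : k % p = p - 1 - i := by
    rw [hkj, Nat.add_mul_mod_self_left, Nat.mod_eq_of_lt (by omega)]
  refine Prod.ext (Fin.ext ?_) hdiv
  simp only [weightEquiv, Equiv.trans_apply, Equiv.prodComm_apply, Equiv.prodCongr_apply,
    Nat.divModEquiv_apply, Prod.swap_prod_mk, Prod.map_apply, Fin.revPerm_apply, Fin.val_rev,
    Fin.val_ofNat, hmod]
  omega

/-- The coefficient `(-1)^i / i!`. -/
def taylorCoeff (F : Type*) [Field F] (i : ℕ) : F := (-1) ^ i * (i.factorial : F)⁻¹

variable {p}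

omit [LieAlgebra F N] [LieRing N] in
theorem isUnit_taylorCoeff (i : Fin p × ℕ) : IsUnit (taylorCoeff F (i.1 : ℕ)) :=
  IsUnit.mk0 _ (mul_ne_zero (pow_ne_zero _ (neg_ne_zero.2 one_ne_zero))
    (inv_ne_zero (cast_factorial_ne_zero i.1.2)))

/-- The basis `(-1)^i / i! • ε^i ⊗ u_j` of `F[ε]/(ε^p) ⊗ I`, indexed by weight. -/
def tensorBasis {I : LieIdeal F N} (b : Module.Basis ℕ F I) :
    Module.Basis ℕ F (Trunc F p ⊗[F] I) :=
  (((truncBasis F p).tensorProduct b).isUnitSMul isUnit_taylorCoeff).reindex (weightEquiv p).symm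

theorem tensorBasis_apply {I : LieIdeal F N} (b : Module.Basis ℕ F I) {k i j : ℕ} (hi : i < p)
    (hk : k + 1 + i = p * (j + 1)) :
    tensorBasis (p := p) b k = taylorCoeff F i • ((eps F p ^ i) ⊗ₜ[F] b j) := by
  rw [tensorBasis, Module.Basis.reindex_apply, Equiv.symm_symm, weightEquiv_apply p hi hk,
    Module.Basis.isUnitSMul_apply, Module.Basis.tensorProduct_apply, truncBasis_apply]

/-- The basis of an inflation which consists of the derivation and the elements of
`tensorBasis`. -/
def inflationBasis {I : LieIdeal F N} (b : Module.Basis ℕ F I) (s : N) :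
    Module.Basis (Option ℕ) F (Inflation p I s) :=
  (((tensorBasis (p := p) b).prod (Module.Basis.singleton PUnit.{1} F)).map
    (LieAlgebra.SemiDirectSum.toProdl (derHom (inflationDer p I s))).symm).reindex
    (Equiv.optionEquivSumPUnit.{0} ℕ).symm

theorem inflationBasis_none {I : LieIdeal F N} (b : Module.Basis ℕ F I) (s : N) :
    inflationBasis (p := p) b s none = ⟨0, 1⟩ := by
  simp [inflationBasis]
  rfl

theorem inflationBasis_some {I : LieIdeal F N} (b : Module.Basis ℕ F I) (s : N) (k : ℕ) :
    inflationBasis (p := p) b s (some k) = ⟨tensorBasis (p := p) b k, 0⟩ := by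
  simp [inflationBasis]
  rfl

omit [Fact p.Prime] in
theorem inflation_lie_left {I : LieIdeal F N} {s : N} (a c : Trunc F p ⊗[F] I) :
    ⁅(⟨a, 0⟩ : Inflation p I s), (⟨c, 0⟩ : Inflation p I s)⁆ = ⟨⁅a, c⁆, 0⟩ := by
  simp

omit [Fact p.Prime] in
theorem inflation_lie_right {I : LieIdeal F N} {s : N} (a : Trunc F p ⊗[F] I) :
    ⁅(⟨a, 0⟩ : Inflation p I s), (⟨0, 1⟩ : Inflation p I s)⁆ = ⟨-inflationDer p I s a, 0⟩ := by
  have h1 : derHom (inflationDer p I s) 1 a = inflationDer p I s a := by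
    change (1 : F) • inflationDer p I s a = _
    rw [one_smul]
  rw [LieAlgebra.SemiDirectSum.lie_eq_mk, h1]
  simp

variable {L : Type*} [LieRing L] [LieAlgebra F L] {𝒢 : ℕ → Submodule F L} [GradedLieAlgebra 𝒢]
variable {x y : L} {v : ℕ → L} {S : ℕ → Prop} {ν : ℕ → ℕ → F}

omit [Fact p.Prime] in
theorem exists_weight (hp : 1 ≤ p) {n : ℕ} (hn : 1 ≤ n) : ∃ i j, i < p ∧ n + i = p * (j + 1) := by
  refine ⟨p - 1 - (n - 1) % p, (n - 1) / p, by omega, ?_⟩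
  have h1 := Nat.div_add_mod (n - 1) p
  have h2 := Nat.mod_lt (n - 1) hp
  rw [mul_add, mul_one]
  omega

/-- An algebra in which the second two-step centralizer occurs only in weights divisible by `p` is
isomorphic to an inflation. -/
theorem IsAdapted.exists_lieEquiv (h : IsAdapted 𝒢 x y v S) (h0 : 𝒢 0 = ⊥) (hp2 : p ≠ 2)
    (hν : ∀ i j, 1 ≤ i → 1 ≤ j → ⁅v i, v j⁆ = ν i j • v (i + j))
    (hS : ∀ i, 1 ≤ i → S i → p ∣ i) {I : LieIdeal F N} (b : Module.Basis ℕ F I) (s : N)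
    (hb : ∀ i j, ⁅b i, b j⁆ = ν (p * (i + 1)) (p * (j + 1)) • b (i + j + 1))
    (hs : ∀ j, S (p * (j + 1)) → idealDer I s (b j) = 0)
    (hs' : ∀ j, ¬ S (p * (j + 1)) → idealDer I s (b j) = b (j + 1)) :
    ∃ e : L ≃ₗ⁅F⁆ Inflation p I s, e x = ⟨0, 1⟩ ∧ ∀ n i j, 1 ≤ n → i < p → n + i = p * (j + 1) →
      e (v n) = ⟨taylorCoeff F i • ((eps F p ^ i) ⊗ₜ[F] b j), 0⟩ := by
  have hp : p.Prime := Fact.out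
  have hc := h.isConstantSystem hν
  let e₀ : L ≃ₗ[F] Inflation p I s := (h.basis h0).equiv (inflationBasis b s) (Equiv.refl _)
  have hx : e₀ x = ⟨0, 1⟩ := by
    have := (h.basis h0).equiv_apply none (inflationBasis (p := p) b s) (Equiv.refl _)
    rwa [h.basis_none h0, Equiv.refl_apply, inflationBasis_none] at this
  have hv : ∀ n i j, 1 ≤ n → i < p → n + i = p * (j + 1) →
      e₀ (v n) = ⟨taylorCoeff F i • ((eps F p ^ i) ⊗ₜ[F] b j), 0⟩ := by
    intro n i j hn hi hnij
    have := (h.basis h0).equiv_apply (some (n - 1)) (inflationBasis (p := p) b s) (Equiv.refl _)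
    rwa [h.basis_some h0, Equiv.refl_apply, inflationBasis_some, Nat.sub_add_cancel hn,
      tensorBasis_apply b hi (j := j) (by omega)] at this
  have hvv : ∀ n m, 1 ≤ n → 1 ≤ m → e₀ ⁅v n, v m⁆ = ⁅e₀ (v n), e₀ (v m)⁆ := by
    intro n m hn hm
    obtain ⟨i, j, hi, hij⟩ := exists_weight hp.pos hn
    obtain ⟨i', j', hi', hij'⟩ := exists_weight hp.pos hm
    have hdn : p ∣ n + i := ⟨_, hij⟩
    have hdm : p ∣ m + i' := ⟨_, hij'⟩
    rw [hν n m hn hm, map_smul, hv n i j hn hi hij, hv m i' j' hm hi' hij', inflation_lie_left,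
      smul_lie, lie_smul, LieAlgebra.ExtendScalars.bracket_tmul, ← pow_add, hb]
    rcases lt_or_ge (i + i') p with hlt | hge
    · rw [hv (n + m) (i + i') (j + j' + 1) (by omega) hlt
          (by rw [show n + m + (i + i') = (n + i) + (m + i') by ring, hij, hij']; ring),
        hc.eq_choose_mul hS hn hm hlt hdn hdm, hij, hij', LieAlgebra.SemiDirectSum.smul_eq_mk,
        smul_zero, TensorProduct.tmul_smul]
      congr 1
      simp only [smul_smul]
      congr 1
      -- The coefficients `(-1)^i / i!` absorb the binomial factor of `eq_choose_mul`.
      have h1 : (((i + i').choose i : F)) * (i.factorial : F) * (i'.factorial : F) =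
          ((i + i').factorial : F) := by
        rw [Nat.choose_symm_add]
        exact_mod_cast congrArg (Nat.cast (R := F))
          (Nat.add_choose_mul_factorial_mul_factorial i i')
      have h2 := cast_factorial_ne_zero (F := F) hi
      have h3 := cast_factorial_ne_zero (F := F) hi'
      have h4 := cast_factorial_ne_zero (F := F) hlt
      rw [taylorCoeff, taylorCoeff, taylorCoeff, pow_add]
      field_simp
      linear_combination ν (p * (j + 1)) (p * (j' + 1)) * h1
    · rw [hc.eq_zero_of_le hS hn hm hi hi' hdn hdm hge, eps_pow_of_le hge, zero_smul,
        TensorProduct.zero_tmul, smul_zero, smul_zero]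
      rfl
  have hvx : ∀ n, 1 ≤ n → e₀ ⁅v n, x⁆ = ⁅e₀ (v n), e₀ x⁆ := by
    intro n hn
    obtain ⟨i, j, hi, hij⟩ := exists_weight hp.pos hn
    rw [hv n i j hn hi hij, hx, inflation_lie_right, map_smul, inflationDer_tmul, truncDer_eps_pow,
      ← pow_add]
    rcases Nat.eq_zero_or_pos i with rfl | hi0
    · rw [add_zero] at hij
      rw [add_zero, Nat.cast_zero, zero_smul, TensorProduct.zero_tmul, zero_add]
      by_cases hSn : S n
      · rw [h.lie_x_of hSn, hs j (hij ▸ hSn), TensorProduct.tmul_zero, smul_zero, neg_zero,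
          map_zero]
        rfl
      · rw [h.lie_x_of_not hn hSn, hs' j (hij ▸ hSn),
          hv (n + 1) (p - 1) (j + 1) (by omega) (by have := hp.pos; omega)
            (by rw [show n + 1 + (p - 1) = n + p by have := hp.pos; omega, hij]; ring),
          ← neg_smul]
        -- At a multiple of `p` only the term `ε^(p-1) ⊗ ad s` acts. Wilson's theorem and the
        -- evenness of `p - 1` make the coefficient of `ε^(p-1)` equal to `-1`, which cancels the
        -- sign of the bracket.
        congr 2
        rw [taylorCoeff, taylorCoeff, cast_factorial_pred,
          (hp.even_sub_one hp2).neg_one_pow]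
        simp
    · have hSn : ¬ S n := by
        intro hSn
        exact Nat.not_dvd_of_pos_of_lt hi0 hi ((Nat.dvd_add_right (hS n hn hSn)).1 ⟨_, hij⟩)
      rw [h.lie_x_of_not hn hSn, eps_pow_of_le (p := p) (n := p - 1 + i) (by omega),
        TensorProduct.zero_tmul, add_zero,
        hv (n + 1) (i - 1) j (by omega) (by omega) (by rw [← hij]; omega),
        ← TensorProduct.smul_tmul', smul_smul, ← neg_smul]
      congr 2
      obtain ⟨a, rfl⟩ : ∃ a, i = a + 1 := ⟨i - 1, by omega⟩
      have h2 := cast_factorial_ne_zero (F := F) hi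
      rw [Nat.factorial_succ, Nat.cast_mul] at h2
      rw [taylorCoeff, taylorCoeff, Nat.factorial_succ, Nat.cast_mul, Nat.add_sub_cancel, pow_succ,
        mul_inv]
      have h3 := left_ne_zero_of_mul h2
      field_simp
  refine ⟨{ e₀ with map_lie' := fun {a c} => ?_ }, hx, hv⟩
  refine map_lie_of_span_eq_top (h.span_eq_top h0) e₀.toLinearMap ?_ a c
  rintro _ ⟨_ | k, rfl⟩ _ ⟨_ | l, rfl⟩
  · simp
  · change e₀ ⁅x, v (l + 1)⁆ = ⁅e₀ x, e₀ (v (l + 1))⁆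
    rw [← lie_skew, map_neg, hvx _ (by omega), lie_skew]
  · exact hvx _ (by omega)
  · exact hvv _ _ (by omega) (by omega)

end InflationEquiv

/-! ### Deflation -/

section Inflated

variable {F L : Type*} [Field F] [LieRing L] [LieAlgebra F L]
variable {𝒢 : ℕ → Submodule F L} [GradedLieAlgebra 𝒢]
variable {x y : L} {v : ℕ → L} {S : ℕ → Prop}
variable {p : ℕ} [Fact p.Prime] [CharP F p]

namespace IsAdapted

omit [GradedLieAlgebra 𝒢] in
theorem ad_x_pow (h : IsAdapted 𝒢 x y v S) {n k : ℕ} (hn : 1 ≤ n) (hS : ∀ l < k, ¬ S (n + l)) :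
    (LieAlgebra.ad F L x ^ k) (v n) = (-1 : F) ^ k • v (n + k) := by
  induction k with
  | zero => simp
  | succ k ih =>
    rw [pow_succ', Module.End.mul_apply, ih fun l hl => hS l (by omega), map_smul,
      LieAlgebra.ad_apply, ← lie_skew, h.lie_x_of_not (by omega) (hS k (by omega)), pow_succ,
      mul_smul, neg_one_smul]
    rfl

omit [GradedLieAlgebra 𝒢] in
-- Between consecutive multiples of `p` there is no element of `S`, so `x` shifts at all `p` steps,
-- and the sign is `(-1)^p = -1`.
theorem adPow_of_not (h : IsAdapted 𝒢 x y v S) (hp2 : p ≠ 2) (hS : ∀ i, 1 ≤ i → S i → p ∣ i)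
    {n : ℕ} (hn : 1 ≤ n) (hpn : p ∣ n) (hSn : ¬ S n) : adPow F p x (v n) = -v (n + p) := by
  have h1 := h.ad_x_pow (k := p) hn (fun l hl => by
    rcases Nat.eq_zero_or_pos l with rfl | hl0
    · exact hSn
    · intro hSl
      exact Nat.not_dvd_of_pos_of_lt hl0 hl ((Nat.dvd_add_right hpn).1 (hS _ (by omega) hSl)))
  rw [((Fact.out : p.Prime).odd_of_ne_two hp2).neg_one_pow, neg_one_smul] at h1
  exact h1

omit [GradedLieAlgebra 𝒢] in
theorem adPow_of (h : IsAdapted 𝒢 x y v S) {n : ℕ} (hSn : S n) : adPow F p x (v n) = 0 := by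
  have hp : p.Prime := Fact.out
  change (LieAlgebra.ad F L x ^ p) (v n) = 0
  obtain ⟨k, hk⟩ : ∃ k, p = k + 1 := ⟨p - 1, by have := hp.pos; omega⟩
  rw [hk, pow_succ, Module.End.mul_apply, LieAlgebra.ad_apply, ← lie_skew, h.lie_x_of hSn, neg_zero,
    map_zero]

omit [CharP F p] in
theorem mem_multiples (h : IsAdapted 𝒢 x y v S) (j : ℕ) :
    v (p * (j + 1)) ∈ multiples p 𝒢 :=
  Submodule.mem_iSup_of_mem (j + 1)
    (h.mem (Nat.mul_pos (Fact.out : p.Prime).pos (Nat.succ_pos j)))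

/-- The elements `v_p, v_{2p}, …` of the deflation. -/
def deflationVec (h : IsAdapted 𝒢 x y v S) (p : ℕ) [Fact p.Prime] [CharP F p] (j : ℕ) :
    Deflation p 𝒢 x h.x_mem :=
  ⟨⟨v (p * (j + 1)), h.mem_multiples j⟩, 0⟩

theorem linearIndependent_deflationVec (h : IsAdapted 𝒢 x y v S) :
    LinearIndependent F (h.deflationVec p) := by
  have hp : p.Prime := Fact.out
  let f : Deflation p 𝒢 x h.x_mem →ₗ[F] L := (multiples p 𝒢).toSubmodule.subtype ∘ₗ
    LieAlgebra.SemiDirectSum.projl _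
  refine LinearIndependent.of_comp f ?_
  exact h.linearIndependent_succ (f := fun j => p * (j + 1))
    (fun a b hab => by simpa [hp.ne_zero] using hab) fun k => Nat.mul_pos hp.pos (Nat.succ_pos k)

theorem deflationVec_mem (h : IsAdapted 𝒢 x y v S) (j : ℕ) :
    h.deflationVec p j ∈ deflationGrading p 𝒢 x h.x_mem (j + 1) :=
  ⟨h.mem (Nat.mul_pos (Fact.out : p.Prime).pos (Nat.succ_pos j)), fun _ => rfl⟩

theorem mem_span_deflationVec (h : IsAdapted 𝒢 x y v S) {j : ℕ} {z : Deflation p 𝒢 x h.x_mem}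
    (hz : z ∈ deflationGrading p 𝒢 x h.x_mem (j + 1)) (hr : z.right = 0) :
    z ∈ Submodule.span F {h.deflationVec p j} := by
  have hp : p.Prime := Fact.out
  have h1 : (z.left : L) ∈ 𝒢 (p * (j + 1)) := hz.1
  rw [h.span_eq (by have := hp.two_le; nlinarith)] at h1
  obtain ⟨c, hc⟩ := Submodule.mem_span_singleton.1 h1
  refine Submodule.mem_span_singleton.2 ⟨c, ?_⟩
  refine LieAlgebra.SemiDirectSum.ext (Subtype.ext hc) ?_
  rw [hr]
  exact smul_zero c

/-- The ideal of the deflation spanned by `v_p, v_{2p}, …`. -/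
def deflationIdeal (h : IsAdapted 𝒢 x y v S) (h0 : 𝒢 0 = ⊥) (p : ℕ) [Fact p.Prime] [CharP F p] :
    LieIdeal F (Deflation p 𝒢 x h.x_mem) :=
  idealOf (deflationGrading p 𝒢 x h.x_mem) (deflationGrading_zero p 𝒢 h0 x h.x_mem)
    (iSup_deflationGrading p 𝒢 x h.x_mem) (Submodule.span F {h.deflationVec p 0})

theorem deflationIdeal_eq_span (h : IsAdapted 𝒢 x y v S) (h0 : 𝒢 0 = ⊥) :
    Submodule.span F (Set.range (h.deflationVec p)) = (h.deflationIdeal h0 p).toSubmodule := by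
  change _ = Submodule.span F {h.deflationVec p 0} ⊔ ⨆ i, deflationGrading p 𝒢 x h.x_mem (i + 2)
  apply le_antisymm
  · rw [Submodule.span_le]
    rintro _ ⟨_ | j, rfl⟩
    · exact Submodule.mem_sup_left (Submodule.mem_span_singleton_self _)
    · exact Submodule.mem_sup_right (Submodule.mem_iSup_of_mem j (h.deflationVec_mem (j + 1)))
  · refine sup_le (Submodule.span_mono (by rintro _ rfl; exact ⟨0, rfl⟩)) (iSup_le fun i z hz => ?_)
    exact Submodule.span_mono (by rintro _ rfl; exact ⟨i + 1, rfl⟩)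
      (h.mem_span_deflationVec (j := i + 1) hz (hz.2 (by omega)))

theorem right_eq_zero (h : IsAdapted 𝒢 x y v S) (h0 : 𝒢 0 = ⊥) {z : Deflation p 𝒢 x h.x_mem}
    (hz : z ∈ h.deflationIdeal h0 p) : z.right = 0 := by
  have hle : (h.deflationIdeal h0 p).toSubmodule ≤
      LinearMap.ker
        (LieAlgebra.SemiDirectSum.projr (derHom (deflationDer p 𝒢 x h.x_mem))).toLinearMap := by
    rw [← h.deflationIdeal_eq_span h0, Submodule.span_le]
    rintro _ ⟨j, rfl⟩
    rfl
  exact hle hz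

/-- The basis `v_p, v_{2p}, …` of the ideal. -/
def deflationBasis (h : IsAdapted 𝒢 x y v S) (h0 : 𝒢 0 = ⊥) (p : ℕ) [Fact p.Prime] [CharP F p] :
    Module.Basis ℕ F (h.deflationIdeal h0 p) :=
  (Module.Basis.span (h.linearIndependent_deflationVec (p := p))).map
    (LinearEquiv.ofEq _ _ (h.deflationIdeal_eq_span h0))

theorem deflationBasis_apply (h : IsAdapted 𝒢 x y v S) (h0 : 𝒢 0 = ⊥) (j : ℕ) :
    (h.deflationBasis h0 p j : Deflation p 𝒢 x h.x_mem) = h.deflationVec p j := by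
  rw [deflationBasis, Module.Basis.map_apply, Module.Basis.span_apply]
  rfl

theorem deflation_lie_left {hx : x ∈ 𝒢 1} (a b : multiples p 𝒢) :
    ⁅(⟨a, 0⟩ : Deflation p 𝒢 x hx), (⟨b, 0⟩ : Deflation p 𝒢 x hx)⁆ = ⟨⁅a, b⁆, 0⟩ := by
  simp

theorem deflation_lie_right {hx : x ∈ 𝒢 1} (c : F) (a : multiples p 𝒢) :
    ⁅(⟨0, c⟩ : Deflation p 𝒢 x hx), (⟨a, 0⟩ : Deflation p 𝒢 x hx)⁆ =
      ⟨c • deflationDer p 𝒢 x hx a, 0⟩ := by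
  have h1 : derHom (deflationDer p 𝒢 x hx) c a = c • deflationDer p 𝒢 x hx a := rfl
  rw [LieAlgebra.SemiDirectSum.lie_eq_mk, h1]
  simp

omit [Fact p.Prime] in
/-- The weight of the elements of the basis of an inflation. -/
theorem tmul_mem_inflationGrading {N : Type*} [LieRing N] [LieAlgebra F N] {ℋ : ℕ → Submodule F N}
    {I : LieIdeal F N} {s : N} {n i j : ℕ} (hi : i < p) (hn : n + i = p * j) {u : I}
    (hu : (u : N) ∈ ℋ j) (c : F) :
    (⟨c • ((eps F p ^ i) ⊗ₜ[F] u), 0⟩ : Inflation p I s) ∈ inflationGrading p ℋ I s n :=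
  ⟨Submodule.mem_iSup_of_mem j (Submodule.mem_iSup_of_mem i (Submodule.mem_iSup_of_mem ⟨hi, hn⟩
    (Submodule.smul_mem _ c ⟨u, hu, rfl⟩))), fun _ => rfl⟩

/-- The line `M` is spanned by `v_p`, so the ideal to be tensored has the basis `v_p, v_{2p}, …`, as
`exists_lieEquiv` requires. -/
theorem isInflated (h : IsAdapted 𝒢 x y v S) (hL : IsMaximalClass 𝒢) (hp2 : p ≠ 2)
    (hS : ∀ i, 1 ≤ i → S i → p ∣ i) : IsInflated p 𝒢 hL := by
  have hp : p.Prime := Fact.out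
  have h0 := hL.zero_eq_bot
  obtain ⟨ν, hν⟩ := h.exists_constants
  have hmul : ∀ j, 1 ≤ p * (j + 1) := fun j => Nat.mul_pos hp.pos (Nat.succ_pos j)
  -- The sign turns `(ad x)^p`, which sends `v_{pj}` to `-v_{p(j+1)}` or to zero, into a shift
  -- without sign.
  let s : Deflation p 𝒢 x h.x_mem := ⟨0, -1⟩
  have hsr : s.right ≠ 0 := neg_ne_zero.2 one_ne_zero
  have hvec : h.deflationVec p 0 ≠ 0 := h.linearIndependent_deflationVec.ne_zero 0
  obtain ⟨e, hex, hev⟩ := h.exists_lieEquiv h0 hp2 hν hS (h.deflationBasis h0 p) s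
    (fun i j => by
      refine Subtype.ext ?_
      change ⁅(h.deflationBasis h0 p i : Deflation p 𝒢 x h.x_mem),
        (h.deflationBasis h0 p j : Deflation p 𝒢 x h.x_mem)⁆ =
        ν (p * (i + 1)) (p * (j + 1)) •
          (h.deflationBasis h0 p (i + j + 1) : Deflation p 𝒢 x h.x_mem)
      rw [h.deflationBasis_apply, h.deflationBasis_apply, h.deflationBasis_apply, deflationVec,
        deflationVec, deflation_lie_left, deflationVec, LieAlgebra.SemiDirectSum.smul_eq_mk,
        smul_zero]
      congr 1
      refine Subtype.ext ?_
      change ⁅v (p * (i + 1)), v (p * (j + 1))⁆ = _ • v (p * (i + j + 1 + 1))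
      rw [hν _ _ (hmul i) (hmul j), show p * (i + 1) + p * (j + 1) = p * (i + j + 1 + 1) by ring])
    (fun j hSj => by
      refine Subtype.ext ?_
      change ⁅s, (h.deflationBasis h0 p j : Deflation p 𝒢 x h.x_mem)⁆ = 0
      rw [h.deflationBasis_apply, deflationVec, deflation_lie_right]
      refine LieAlgebra.SemiDirectSum.ext (Subtype.ext ?_) rfl
      change (-1 : F) • adPow F p x (v (p * (j + 1))) = 0
      rw [h.adPow_of hSj, smul_zero])
    (fun j hSj => by
      refine Subtype.ext ?_
      change ⁅s, (h.deflationBasis h0 p j : Deflation p 𝒢 x h.x_mem)⁆ =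
        (h.deflationBasis h0 p (j + 1) : Deflation p 𝒢 x h.x_mem)
      rw [h.deflationBasis_apply, h.deflationBasis_apply, deflationVec, deflation_lie_right]
      refine LieAlgebra.SemiDirectSum.ext (Subtype.ext ?_) rfl
      change (-1 : F) • adPow F p x (v (p * (j + 1))) = v (p * (j + 1 + 1))
      rw [h.adPow_of_not hp2 hS (hmul j) (Dvd.intro _ rfl) hSj, neg_one_smul, neg_neg]
      congr 1)
  have hfwd : ∀ n w, w ∈ 𝒢 n → e w ∈
      inflationGrading p (deflationGrading p 𝒢 x h.x_mem) (h.deflationIdeal h0 p) s n := by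
    intro n w hw
    have hvn : ∀ n, 1 ≤ n →
        e (v n) ∈ inflationGrading p (deflationGrading p 𝒢 x h.x_mem) (h.deflationIdeal h0 p) s
          n := by
      intro n hn
      obtain ⟨i, j, hi, hij⟩ := exists_weight hp.pos hn
      rw [hev n i j hn hi hij]
      refine tmul_mem_inflationGrading hi hij ?_ _
      rw [h.deflationBasis_apply]
      exact h.deflationVec_mem j
    rcases n with _ | _ | n
    · rw [h0, Submodule.mem_bot] at hw
      rw [hw, map_zero]; exact zero_mem _
    · rw [zero_add, h.span_one, Submodule.mem_span_pair] at hw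
      obtain ⟨a, c, rfl⟩ := hw
      rw [map_add, map_smul, map_smul]
      refine add_mem (Submodule.smul_mem _ _ ?_) (Submodule.smul_mem _ _ ?_)
      · rw [hex]
        exact ⟨zero_mem _, fun h1 => absurd rfl h1⟩
      · have h1 := hvn 1 le_rfl
        rw [h.one_eq] at h1
        exact h1
    · rw [h.span_eq (by omega)] at hw
      obtain ⟨c, rfl⟩ := Submodule.mem_span_singleton.1 hw
      rw [map_smul]
      exact Submodule.smul_mem _ _ (hvn _ (by omega))
  have hbwd : ∀ n w, e w ∈
      inflationGrading p (deflationGrading p 𝒢 x h.x_mem) (h.deflationIdeal h0 p) s n →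
        w ∈ 𝒢 n := by
    intro n w hw
    let f : Trunc F p ⊗[F] (h.deflationIdeal h0 p) →ₗ[F] L :=
      e.symm.toLinearEquiv.toLinearMap ∘ₗ
        (LieAlgebra.SemiDirectSum.inl
          (derHom (inflationDer p (h.deflationIdeal h0 p) s))).toLinearMap
    have hf : ∀ a, f a = e.symm ⟨a, 0⟩ := fun a => rfl
    have hleft : f (e w).left ∈ 𝒢 n := by
      have hle : (⨆ (j : ℕ) (i : ℕ) (_ : i < p ∧ n + i = p * j),
          ((deflationGrading p 𝒢 x h.x_mem j).comap (h.deflationIdeal h0 p).toSubmodule.subtype).map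
            (TensorProduct.mk F (Trunc F p) (h.deflationIdeal h0 p) (eps F p ^ i))) ≤
          (𝒢 n).comap f := by
        refine iSup_le fun j => iSup_le fun i => iSup_le fun hij => ?_
        rintro _ ⟨u, hu, rfl⟩
        change f ((eps F p ^ i) ⊗ₜ[F] u) ∈ 𝒢 n
        have hu' : (u : Deflation p 𝒢 x h.x_mem) ∈ deflationGrading p 𝒢 x h.x_mem j := hu
        rcases j with _ | j
        · rw [deflationGrading_zero p 𝒢 h0 x h.x_mem, Submodule.mem_bot] at hu'
          obtain rfl : u = 0 := Subtype.ext hu'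
          rw [TensorProduct.tmul_zero, map_zero]; exact zero_mem _
        · obtain ⟨c, hc⟩ := Submodule.mem_span_singleton.1
            (h.mem_span_deflationVec hu' (h.right_eq_zero h0 u.2))
          obtain rfl : c • h.deflationBasis h0 p j = u := by
            refine Subtype.ext ?_
            rw [← hc, ← h.deflationBasis_apply h0 j]
            rfl
          have hn : 1 ≤ n := by
            have := hij.2
            rw [mul_add, mul_one] at this
            have := hij.1
            omega
          have h1 := hev n i j hn hij.1 hij.2
          have h2 : f (taylorCoeff F i • ((eps F p ^ i) ⊗ₜ[F] h.deflationBasis h0 p j)) = v n := by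
            rw [hf, ← h1]; exact e.symm_apply_apply _
          have hunit := (isUnit_taylorCoeff (F := F) (p := p) (⟨i, hij.1⟩, 0)).ne_zero
          rw [map_smul] at h2
          rw [TensorProduct.tmul_smul, map_smul]
          refine Submodule.smul_mem _ _ ?_
          have h3 : f ((eps F p ^ i) ⊗ₜ[F] h.deflationBasis h0 p j) =
              (taylorCoeff F i)⁻¹ • v n := by
            rw [← h2, smul_smul, inv_mul_cancel₀ hunit, one_smul]
          rw [h3]
          exact Submodule.smul_mem _ _ (h.mem hn)
      exact hle hw.1
    -- The derivation corresponds to `x`, so membership in `𝒢 n` is checked on the two summands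
    -- separately.
    have hsplit : w = f (e w).left + (e w).right • x := by
      apply e.injective
      change e w = e (f (e w).left + (e w).right • x)
      rw [map_add, map_smul, hex, hf]
      have h1 : e (e.symm ⟨(e w).left, 0⟩) = ⟨(e w).left, 0⟩ := e.apply_symm_apply _
      rw [h1]
      refine LieAlgebra.SemiDirectSum.ext ?_ ?_
      · change (e w).left = (e w).left + (e w).right • 0
        rw [smul_zero, add_zero]
      · change (e w).right = 0 + (e w).right • 1
        rw [zero_add, smul_eq_mul, mul_one]
    rw [hsplit]
    refine add_mem hleft ?_
    by_cases hn1 : n = 1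
    · rw [hn1]; exact Submodule.smul_mem _ _ h.x_mem
    · rw [hw.2 hn1, zero_smul]; exact zero_mem _
  refine ⟨x, h.x_mem, ?_, Submodule.span F {h.deflationVec p 0}, ?_, finrank_span_singleton hvec,
    s, ⟨zero_mem _, fun h1 => absurd rfl h1⟩, ?_, e, fun n w => ⟨hfwd n w, hbwd n w⟩⟩
  · intro hx2
    have h2 := hx2.2 _ (h.mem (n := 2) (by omega))
    have hS2 : ¬ S 2 := fun hS2 => ((h.S_iff 2).1 hS2).2 rfl
    rw [← lie_skew, h.lie_x_of_not (by omega) hS2, neg_eq_zero] at h2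
    exact h.ne_zero (by omega) h2
  · rw [Submodule.span_singleton_le_iff_mem]
    exact h.deflationVec_mem 0
  · intro hsM
    obtain ⟨c, hc⟩ := Submodule.mem_span_singleton.1 hsM
    apply hsr
    rw [← hc]
    exact smul_zero c

end IsAdapted

end Inflated

end MaximalClass

end

/-! ### The main theorem -/

open MaximalClass in
theorem mainTheorem6 {F L : Type*} [Field F] (p : ℕ) [Fact p.Prime] [CharP F p] (hp : p ≠ 2)
    [LieRing L] [LieAlgebra F L] (𝒢 : ℕ → Submodule F L) [GradedLieAlgebra 𝒢]
    (hL : MaximalClass.IsMaximalClass 𝒢) (hinf : ¬ Module.Finite F L)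
    (htwo : (MaximalClass.twoStepSet 𝒢).ncard = 2)
    (hlong : ∃ i m, MaximalClass.IsSecondNonShort 𝒢 i m ∧ MaximalClass.IsLong 𝒢 m) :
    (∀ i m, MaximalClass.IsConstituent 𝒢 i m →
      MaximalClass.IsShort 𝒢 m ∨ MaximalClass.IsLong 𝒢 m) ∧
    MaximalClass.IsInflated p 𝒢 hL := by
  classical
  obtain ⟨x, y, v, S, h⟩ := hL.exists_isAdapted hinf htwo
  obtain ⟨ν, hν⟩ := h.exists_constants
  have hc := h.isConstantSystem hν
  obtain ⟨i, m, ⟨hcon, hns, hcard⟩, hlm⟩ := hlong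
  have hS2 : ∀ j, S j → 2 ≤ j := fun j hj => ((h.S_iff j).1 hj).1
  have hSex : ∃ n, S n := by
    rcases Nat.eq_zero_or_pos i with rfl | hi
    · rcases hcon with ⟨_, h2, hlast, _⟩ | ⟨_, _, h2, _⟩
      · exact ⟨m, (h.S_iff m).2 ⟨h2, hlast⟩⟩
      · omega
    · exact ⟨i, ((h.isConstituent_iff hi).1 hcon).start⟩
  have hfirst : S (Nat.find hSex) := Nat.find_spec hSex
  have hmin : ∀ j, 1 ≤ j → j < Nat.find hSex → ¬ S j := fun j _ hj => Nat.find_min hSex hj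
  have hn1 : 1 ≤ Nat.find hSex := by have := hS2 _ hfirst; omega
  obtain ⟨t, ht, hn, -⟩ := hc.exists_parameter hn1 hfirst hmin hp
  rw [hn] at hfirst hmin hn1
  have hq : 0 < p ^ t := by omega
  have hlen := h.firstLength_eq hfirst hmin
  have hzero : ∀ l, IsConstituent 𝒢 0 l ↔ l = 2 * p ^ t :=
    fun l => h.isConstituent_zero_iff hfirst hmin
  have hSle : ∀ u, S u → 2 * p ^ t ≤ u := by
    intro u hu
    by_contra hlt
    exact hmin u (by have := hS2 u hu; omega) (by omega) hu
  rw [IsLong, hlen] at hlm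
  subst hlm
  -- No constituent precedes position `0`, so the count of earlier non-short ones would be zero
  -- instead of one.
  have hi0 : 1 ≤ i := by
    by_contra hi
    obtain rfl : i = 0 := by omega
    simp at hcard
  have hgap := (h.isConstituent_iff hi0).1 hcon
  obtain ⟨z, hz⟩ := Set.ncard_eq_one.1 hcard
  have h0mem : 0 ∈ {j : ℕ | j < i ∧ ∃ l, IsConstituent 𝒢 j l ∧ ¬ IsShort 𝒢 l} := by
    refine ⟨hi0, _, (hzero _).2 rfl, ?_⟩
    rw [IsShort, hlen]; omega
  -- The first constituent, at position `0`, is already the unique earlier non-short one.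
  have hshort : ∀ u m, 2 * p ^ t ≤ u → u < i → Gap S u m → m = p ^ t := by
    intro u m hu hui hg
    by_contra hne
    have hu1 : 1 ≤ u := by omega
    have humem : u ∈ {j : ℕ | j < i ∧ ∃ l, IsConstituent 𝒢 j l ∧ ¬ IsShort 𝒢 l} := by
      refine ⟨hui, m, (h.isConstituent_iff hu1).2 hg, ?_⟩
      rw [IsShort, hlen]; omega
    rw [hz, Set.mem_singleton_iff] at h0mem humem
    omega
  have hall : ∀ {u l}, Gap S u l → l = p ^ t ∨ l = 2 * p ^ t := fun {u l} hg =>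
    hc.gap_short_or_long hp hfirst hmin hgap (hSle i hgap.start) hshort (hSle u hg.start) hg
  refine ⟨fun u l hul => ?_, h.isInflated hL hp fun u hu1 hu => ?_⟩
  · rw [IsShort, IsLong, hlen]
    rcases Nat.eq_zero_or_pos u with rfl | hu
    · exact Or.inr ((hzero l).1 hul)
    · rcases hall ((h.isConstituent_iff hu).1 hul) with h1 | h1 <;> omega
  · have hpq : p ∣ p ^ t := dvd_pow_self p (by omega)
    induction u using Nat.strong_induction_on with
    | _ u ih =>
    rcases eq_or_lt_of_le (hSle u hu) with heq | hlt
    · rw [← heq]; exact hpq.mul_left 2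
    · have hex : ∃ w, w < u ∧ S w := ⟨_, hlt, hfirst⟩
      -- The element of `S` just before `u`; the two differ by a constituent length, which is a
      -- multiple of `p`.
      set w := Nat.findGreatest (fun w => w < u ∧ S w) u with hw
      have hws : w < u ∧ S w :=
        Nat.findGreatest_spec (P := fun w => w < u ∧ S w) hlt.le ⟨hlt, hfirst⟩
      have hg : Gap S w (u - w) := by
        refine ⟨hws.2, by omega, by rw [Nat.add_sub_cancel' hws.1.le]; exact hu,
          fun j hj1 hj hSj => ?_⟩
        exact Nat.findGreatest_is_greatest (P := fun w => w < u ∧ S w) (n := u) (k := w + j)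
          (by omega) (by omega) ⟨by omega, hSj⟩
      have hwd := ih w hws.1 (by have := hS2 w hws.2; omega) hws.2
      have hd : p ∣ u - w := by
        rcases hall hg with h1 | h1 <;> rw [h1]
        · exact hpq
        · exact hpq.mul_left 2
      have := dvd_add hwd hd
      rwa [Nat.add_sub_cancel' hws.1.le] at this
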